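/- Let $\mathbb{P}$ be Cohen forcing with locks. Its conditions are the tuples $p=(\sigma_0,\dots,\sigma_{k-1},f)$ where the $\sigma_i$ are finite binary strings and $f:\{0,\dots,k-1\}\to\{0,1,u\}$. A condition $q=(\tau_0,\dots,\tau_{\ell-1},g)$ extends $p$ if $\ell\ge k$, $g$ extends $f$, $\sigma_i\preceq\tau_i$ for all $i<k$, and $\tau_i(x)=f(i)$ for all $i<k$ with $f(i)\in\{0,1\}$ and all $x$ with $|\sigma_i|\le x<|\tau_i|$. For a filter $\mathcal{G}$ on $\mathbb{P}$ let $R^{\mathcal G}_i=\{x : \sigma_i(x)=1 \text{ for some } (\sigma_0,\dots,\sigma_{k-1},f)\in\mathcal G \text{ with } i<k\}$, let $\vec R^{\mathcal G}=\langle R_0^{\mathcal G},R_1^{\mathcal G},\dots\rangle$ (coded as the set $\{\langle i,x\rangle : x\in R_i^{\mathcal G}\}$), and let $U^{\mathcal G}$ be the set of unlocked columns, i.e. of all $i$ such that $f(i)=u$ for some $(\sigma_0,\dots,\sigma_{k-1},f)\in\mathcal G$ with $i<k$. A set $C\subseteq\omega$ is cohesive for a sequence $\vec R$ if for every $i$ one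 of $C\setminus R_i$, $C\cap R_i$ is finite; the solutions of the $\mathsf{COH}$-instance $\vec R$ are its infinite cohesive sets. A set $X$ is of PA degree relative to $Y$ if every infinite $Y$-computable tree $T\subseteq 2^{<\omega}$ has an $X$-computable infinite path. An $A$-computable instance $\vec R$ of $\mathsf{COH}$ is universal (for $A$) if for every $A$-computable instance $\vec S$ and every solution $C$ to $\vec R$, the set $A\oplus C$ computes a solution to $\vec S$. **Corollary.** Let $\mathcal G$ be a sufficiently generic filter on $\mathbb{P}$; that is, there is an $n\in\omega$ such that the following holds for every filter $\mathcal G$ on $\mathbb P$ that meets every dense set of conditions computable from $\emptyset^{(n)}$. There is an infinite $\vec R^{\mathcal G}$-cohesive set $C$, computable from $\vec R^{\mathcal G}\oplus U^{\mathcal G}$, such that $(\vec R^{\mathcal G}\oplus C)'$ is not of PA degree relative to $\emptyset'$; in particular $(\vec R^{\mathcal G}\oplus C)'$ is not of PA degree relative to $(\vec R^{\mathcal G})'$. Hence $\vec R^{\mathcal G}$ is not a universal instance of $\mathsf{COH}$ (among the $\vec R^{\mathcal G}$-computable instances). -/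

import Mathlib

namespace CohLocks

noncomputable section

/-! ### Turing reducibility, jumps, and PA degrees for sets of natural numbers -/

open Classical in
/-- The characteristic function of a set of natural numbers, as an oracle. -/
def charFn (A : Set ℕ) : ℕ →. ℕ := fun n => Part.some (if n ∈ A then 1 else 0)

/-- `A` is Turing reducible to (computable from) `B`. -/
def SetReducible (A B : Set ℕ) : Prop := TuringReducible (charFn A) (charFn B)

/-- The join `A ⊕ B`. -/
def join (A B : Set ℕ) : Set ℕ := {m | ∃ n, (m = 2 * n ∧ n ∈ A) ∨ (m = 2 * n + 1 ∧ n ∈ B)}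

open Classical in
/-- The binary string `A(0) A(1) ⋯ A(n-1)`. -/
def initSeg (A : Set ℕ) (n : ℕ) : List Bool := (List.range n).map fun x => decide (x ∈ A)

/-- The `e`-th set `W_e^A` computably enumerable in `A`: the input `x` is enumerated when the
`e`-th program halts on `x` together with some finite initial segment of the oracle. -/
def enumSet (e : ℕ) (A : Set ℕ) : Set ℕ :=
  {x | ∃ n : ℕ, ((Denumerable.ofNat Nat.Partrec.Code e).eval
    (Encodable.encode (x, initSeg A n))).Dom}

/-- The Turing jump `A' = {e | e ∈ W_e^A}`. -/
def jump (A : Set ℕ) : Set ℕ := {e | e ∈ enumSet e A}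

/-- `T` is a binary tree: a set of binary strings closed under initial segments. -/
def IsBinaryTree (T : Set (List Bool)) : Prop := ∀ σ τ : List Bool, τ ∈ T → σ <+: τ → σ ∈ T

/-- `X` is of PA degree relative to `Y` (`deg X ≫ deg Y`): every infinite `Y`-computable
binary tree has an `X`-computable infinite path. -/
def IsPARelativeTo (X Y : Set ℕ) : Prop :=
  ∀ T : Set (List Bool), IsBinaryTree T → T.Infinite → SetReducible (Encodable.encode '' T) Y →
    ∃ P : Set ℕ, SetReducible P X ∧ ∀ n, initSeg P n ∈ T

/-! ### The cohesiveness principle -/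

/-- A sequence of sets coded as the single set `{⟨i, x⟩ | x ∈ R i}`. -/
def seqCode (R : ℕ → Set ℕ) : Set ℕ := {m | (Nat.unpair m).2 ∈ R (Nat.unpair m).1}

/-- `C` is cohesive for the sequence `R`: for each `i`, `C ⊆* R i` or `C ⊆* (R i)ᶜ`. -/
def IsCohesive (R : ℕ → Set ℕ) (C : Set ℕ) : Prop :=
  ∀ i, (C \ R i).Finite ∨ (C \ (R i)ᶜ).Finite

/-- `C` is a solution to the `COH`-instance `R`: an infinite cohesive set for `R`. -/
def IsCohSolution (R : ℕ → Set ℕ) (C : Set ℕ) : Prop := C.Infinite ∧ IsCohesive R C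

/-- `R` is a universal instance of `COH` among the `A`-computable ones: it is `A`-computable, and
for every solution `C` to `R`, the set `A ⊕ C` computes a solution to each `A`-computable
instance `S`. -/
def IsUniversalCohInstance (A : Set ℕ) (R : ℕ → Set ℕ) : Prop :=
  SetReducible (seqCode R) A ∧
    ∀ S : ℕ → Set ℕ, SetReducible (seqCode S) A →
      ∀ C : Set ℕ, IsCohSolution R C →
        ∃ D : Set ℕ, SetReducible D (join A C) ∧ IsCohSolution S D

/-! ### Cohen forcing with locks -/

/-- A condition `(σ₀, …, σ_{k-1}, f)`, given as the list of the pairs `(σᵢ, f(i))`, `i < k`.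
The value `f(i) ∈ {0, 1, u}` is an `Option Bool`, with `none` for `u` (unlocked). -/
@[ext]
structure LockCondition where
  columns : List (List Bool × Option Bool)

/-- `q ≤ p` (`q` extends `p`): `q` has at least as many columns; on each column of `p` it has the
same lock value and an extension of the string, and the new entries of a column that `p` locks to
`b` are all equal to `b`. -/
instance : Preorder LockCondition where
  le q p := p.columns.length ≤ q.columns.length ∧
    ∀ (i : ℕ) (σ : List Bool) (a : Option Bool), p.columns[i]? = some (σ, a) →
      ∃ τ : List Bool, q.columns[i]? = some (τ, a) ∧ σ <+: τ ∧
        ∀ b : Bool, a = some b → ∀ x, σ.length ≤ x → x < τ.length → τ[x]? = some b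
  le_refl p := by
    refine ⟨le_rfl, fun i σ a h => ⟨σ, h, List.prefix_rfl, fun b _ x h1 h2 => ?_⟩⟩
    omega
  le_trans r q p hrq hqp := by
    refine ⟨hqp.1.trans hrq.1, fun i σ a h => ?_⟩
    obtain ⟨τ, hτ, hστ, hb⟩ := hqp.2 i σ a h
    obtain ⟨ρ, hρ, hτρ, hb2⟩ := hrq.2 i τ a hτ
    refine ⟨ρ, hρ, hστ.trans hτρ, fun b hab x h1 h2 => ?_⟩
    by_cases hx : x < τ.length
    · have h3 := hb b hab x h1 hx
      obtain ⟨t, rfl⟩ := hτρ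
      rw [List.getElem?_append_left hx]
      exact h3
    · exact hb2 b hab x (not_lt.mp hx) h2

/-- A set of conditions is dense if every condition has an extension in it. -/
def IsDense (D : Set LockCondition) : Prop := ∀ p : LockCondition, ∃ q ∈ D, q ≤ p

/-- The set of natural numbers coding a set of conditions. -/
def conditionCodes (D : Set LockCondition) : Set ℕ :=
  (fun p : LockCondition => Encodable.encode p.columns) '' D

/-- The filter `G` is generic at level `n`: it meets every dense set of conditions that is
computable from the `n`-th jump of the empty set. -/
def IsGenericAtLevel (n : ℕ) (G : Order.PFilter LockCondition) : Prop :=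
  ∀ D : Set LockCondition, IsDense D → SetReducible (conditionCodes D) (jump^[n] ∅) →
    ∃ p ∈ G, p ∈ D

/-- The `i`-th generic set `R_i^G`: the union of the `i`-th strings of the conditions in `G`, a
string being identified with the finite set of positions of its ones. -/
def genericSet (G : Order.PFilter LockCondition) (i : ℕ) : Set ℕ :=
  {x | ∃ p ∈ G, ∃ (σ : List Bool) (a : Option Bool),
    p.columns[i]? = some (σ, a) ∧ σ[x]? = some true}

/-- The set `U = {i | f^G(i) = u}` of unlocked columns. -/
def unlockedColumns (G : Order.PFilter LockCondition) : Set ℕ :=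
  {i | ∃ p ∈ G, ∃ σ : List Bool, p.columns[i]? = some (σ, none)}

end

end CohLocks

open CohLocks

/-! Fix disjoint sets `A` and `B`, enumerable in `∅'`, that no `∅'`-computable set separates. Their
separating sets form a class containing all paths of an infinite `∅'`-computable tree, so a set of
PA degree relative to `∅'`, or to any oracle computing `∅'`, computes a separator. It is enough to
find a cohesive `C` computable from `R ⊕ U` and to show that `(R ⊕ U)'` computes no separator.

Locked columns are eventually constant and impose nothing on `C`. Unlocked columns are generic, so
finitely many of them have common elements of any prescribed first coordinate. Knowing `U`, one
picks for each `s` an element of all unlocked columns below `s` (`IsGenericAtLevel.isCohSolution`).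

The core is `IsGenericAtLevel.not_separates`. A condition decides finitely much of `R ⊕ U`, and
extension is enumerable, so forcing a `Π₁` fact is `Π₁`, and "some extension forces this `Σ₂` fact"
is enumerable in `∅'`. Let `P` and its complement be `Σ₂` in `R ⊕ U`. If, below `p`, each `e` has an
extension deciding `e ∈ P`, then reduction turns the two enumerations of possible answers into an
`∅'`-computable set. It fails to separate `A` and `B` at some `e`, and the corresponding extension
forces `P` to fail there too.

For universality, `exists_cohInstance_separating` gives a computable instance each of whose
solutions has a jump computing a separator; hence `R ⊕ C` computes no solution to it. -/

namespace CohLocks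

open Encodable

/-! ### Automation for primitive recursive functions and predicates -/

section PrimrecAutomation

variable {α β γ : Type*} [Primcodable α] [Primcodable β] [Primcodable γ]

theorem primrec_fst {f : α → β × γ} (h : Primrec f) : Primrec fun a => (f a).1 :=
  Primrec.fst.comp h

theorem primrec_snd {f : α → β × γ} (h : Primrec f) : Primrec fun a => (f a).2 :=
  Primrec.snd.comp h

theorem primrec_add {f g : α → ℕ} (hf : Primrec f) (hg : Primrec g) :
    Primrec fun a => f a + g a := Primrec.nat_add.comp hf hg

theorem primrec_mul {f g : α → ℕ} (hf : Primrec f) (hg : Primrec g) :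
    Primrec fun a => f a * g a := Primrec.nat_mul.comp hf hg

theorem primrec_natPair {f g : α → ℕ} (hf : Primrec f) (hg : Primrec g) :
    Primrec fun a => Nat.pair (f a) (g a) := Primrec₂.natPair.comp hf hg

theorem primrec_unpair {f : α → ℕ} (hf : Primrec f) : Primrec fun a => Nat.unpair (f a) :=
  Primrec.unpair.comp hf

theorem primrec_encode {f : α → β} (hf : Primrec f) : Primrec fun a => encode (f a) :=
  Primrec.encode.comp hf

theorem primrec_decode {f : α → ℕ} (hf : Primrec f) :
    Primrec fun a => (decode (f a) : Option β) :=
  Primrec.decode.comp hf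

theorem primrec_some {f : α → β} (hf : Primrec f) : Primrec fun a => some (f a) :=
  Primrec.option_some.comp hf

theorem primrec_isNone {f : α → Option β} (hf : Primrec f) : Primrec fun a => (f a).isNone := by
  refine (Primrec.not.comp (Primrec.option_isSome.comp hf)).of_eq fun a => ?_
  cases f a <;> rfl

theorem primrec_length {f : α → List β} (hf : Primrec f) : Primrec fun a => (f a).length :=
  Primrec.list_length.comp hf

theorem primrec_take {f : α → ℕ} {g : α → List β} (hf : Primrec f) (hg : Primrec g) :
    Primrec fun a => (g a).take (f a) := Primrec.list_take.comp hf hg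

theorem primrec_append {f g : α → List β} (hf : Primrec f) (hg : Primrec g) :
    Primrec fun a => f a ++ g a := Primrec.list_append.comp hf hg

theorem primrec_getElem? {f : α → ℕ} {g : α → List β} (hf : Primrec f) (hg : Primrec g) :
    Primrec fun a => (g a)[f a]? := Primrec.list_getElem?.comp hg hf

end PrimrecAutomation

attribute [fun_prop] Primrec
attribute [fun_prop] Primrec.id Primrec.const Primrec.comp Primrec.pair primrec_fst primrec_snd
  primrec_add primrec_mul primrec_natPair primrec_unpair primrec_encode primrec_decode
  primrec_some primrec_isNone primrec_length primrec_take primrec_append primrec_getElem?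

variable {α β : Type*} [Primcodable α] [Primcodable β]

theorem _root_.PrimrecPred.eq_of {f g : α → β} (hf : Primrec f) (hg : Primrec g) :
    PrimrecPred fun a => f a = g a := Primrec.eq.comp hf hg

theorem _root_.PrimrecPred.lt_of {f g : α → ℕ} (hf : Primrec f) (hg : Primrec g) :
    PrimrecPred fun a => f a < g a := Primrec.nat_lt.comp hf hg

theorem _root_.PrimrecPred.le_of {f g : α → ℕ} (hf : Primrec f) (hg : Primrec g) :
    PrimrecPred fun a => f a ≤ g a := Primrec.nat_le.comp hf hg

theorem _root_.PrimrecPred.exists_lt_of {f : α → ℕ} {p : ℕ → α → Prop} (hf : Primrec f)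
    (hp : PrimrecPred fun x : ℕ × α => p x.1 x.2) : PrimrecPred fun a => ∃ i < f a, p i a :=
  ((PrimrecRel.exists_mem_list (R := p) hp).comp (Primrec.list_range.comp hf) Primrec.id).of_eq
    fun a => by simp

theorem _root_.PrimrecPred.forall_lt_of {f : α → ℕ} {p : ℕ → α → Prop} (hf : Primrec f)
    (hp : PrimrecPred fun x : ℕ × α => p x.1 x.2) : PrimrecPred fun a => ∀ i < f a, p i a :=
  ((PrimrecRel.forall_mem_list (R := p) hp).comp (Primrec.list_range.comp hf) Primrec.id).of_eq
    fun a => by simp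

theorem _root_.PrimrecPred.exists_eq_some {f : α → Option β} {p : β → α → Prop} (hf : Primrec f)
    (hp : PrimrecPred fun x : β × α => p x.1 x.2) :
    PrimrecPred fun a => ∃ b, f a = some b ∧ p b a := by
  classical
  have hg : Primrec₂ fun (a : α) (b : β) => decide (p b a) :=
    hp.decide.comp (f := fun x : β × α => decide (p x.1 x.2)) (g := fun x : α × β => (x.2, x.1))
      (by fun_prop)
  have h := Primrec.option_casesOn hf (Primrec.const false) hg
  refine Primrec.primrecPred (h.of_eq fun a => ?_)
  cases f a <;> simp

/-! ### Predicates enumerable or decidable in an oracle -/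

@[simp] theorem length_initSeg (X : Set ℕ) (n : ℕ) : (initSeg X n).length = n := by
  simp [initSeg]

theorem take_initSeg (X : Set ℕ) {m n : ℕ} (h : m ≤ n) : (initSeg X n).take m = initSeg X m := by
  simp [initSeg, ← List.map_take, List.take_range, h]

theorem initSeg_getElem?_eq_some (X : Set ℕ) {n i : ℕ} {b : Bool} :
    (initSeg X n)[i]? = some b ↔ i < n ∧ (i ∈ X ↔ b = true) := by
  by_cases h : i < n
  · simp [initSeg, h]
    by_cases hi : i ∈ X <;> cases b <;> simp [hi]
  · simp [initSeg, h]

/-- `p` is computably enumerable in `X`. -/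
def CEIn (X : Set ℕ) (p : α → Prop) : Prop :=
  ∃ r : α × ℕ × List Bool → Prop, PrimrecPred r ∧ ∀ a, p a ↔ ∃ n, r (a, n, initSeg X n)

/-- `p` and its complement are computably enumerable in `X`. -/
def DeltaIn (X : Set ℕ) (p : α → Prop) : Prop := CEIn X p ∧ CEIn X fun a => ¬ p a

variable {X Y : Set ℕ}

namespace CEIn

theorem of_iff {p q : α → Prop} (hp : CEIn X p) (h : ∀ a, q a ↔ p a) : CEIn X q := by
  rwa [show q = p from funext fun a => propext (h a)]

theorem of_primrec {p : α → Prop} (hp : PrimrecPred p) : CEIn X p :=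
  ⟨fun x => p x.1, hp.comp Primrec.fst, fun a => by simp⟩

theorem comp {p : β → Prop} (hp : CEIn X p) {f : α → β} (hf : Primrec f) :
    CEIn X fun a => p (f a) := by
  obtain ⟨r, hr, h⟩ := hp
  exact ⟨fun x => r (f x.1, x.2), hr.comp (f := fun x : α × ℕ × List Bool => (f x.1, x.2))
    (by fun_prop), fun a => h _⟩

/-- The matrix need not be monotone in the oracle segment, so the larger witness may not serve for
both. The two witnesses are paired and the segment is cut back to each. -/
theorem and {p q : α → Prop} (hp : CEIn X p) (hq : CEIn X q) : CEIn X fun a => p a ∧ q a := by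
  obtain ⟨r, hr, h⟩ := hp
  obtain ⟨s, hs, h'⟩ := hq
  refine ⟨fun x => r (x.1, (Nat.unpair x.2.1).1, x.2.2.take (Nat.unpair x.2.1).1) ∧
    s (x.1, (Nat.unpair x.2.1).2, x.2.2.take (Nat.unpair x.2.1).2),
    (hr.comp (by fun_prop)).and (hs.comp (by fun_prop)), fun a => ?_⟩
  refine (and_congr (h a) (h' a)).trans ?_
  constructor
  · rintro ⟨⟨m, hm⟩, k, hk⟩
    refine ⟨Nat.pair m k, ?_⟩
    simp [take_initSeg, Nat.left_le_pair, Nat.right_le_pair, hm, hk]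
  · rintro ⟨n, h1, h2⟩
    simp only [take_initSeg, Nat.unpair_left_le, Nat.unpair_right_le] at h1 h2
    exact ⟨⟨_, h1⟩, _, h2⟩

theorem or {p q : α → Prop} (hp : CEIn X p) (hq : CEIn X q) : CEIn X fun a => p a ∨ q a := by
  obtain ⟨r, hr, h⟩ := hp
  obtain ⟨s, hs, h'⟩ := hq
  exact ⟨fun x => r x ∨ s x, hr.or hs, fun a =>
    (or_congr (h a) (h' a)).trans exists_or.symm⟩

theorem ex {p : α → β → Prop} (hp : CEIn X fun x : α × β => p x.1 x.2) :
    CEIn X fun a => ∃ b, p a b := by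
  obtain ⟨r, hr, h⟩ := hp
  refine ⟨fun x => ∃ b : β, decode (Nat.unpair x.2.1).2 = some b ∧
    r ((x.1, b), (Nat.unpair x.2.1).1, x.2.2.take (Nat.unpair x.2.1).1),
    PrimrecPred.exists_eq_some (by fun_prop) (hr.comp (by fun_prop)), fun a => ?_⟩
  constructor
  · rintro ⟨b, hb⟩
    obtain ⟨m, hm⟩ := (h (a, b)).1 hb
    refine ⟨Nat.pair m (encode b), b, by simp, ?_⟩
    simp [take_initSeg, Nat.left_le_pair, hm]
  · rintro ⟨n, b, -, hr⟩
    simp only [take_initSeg, Nat.unpair_left_le] at hr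
    exact ⟨b, (h (a, b)).2 ⟨_, hr⟩⟩

theorem forall_lt {f : α → ℕ} {p : α → ℕ → Prop} (hf : Primrec f)
    (hp : CEIn X fun x : α × ℕ => p x.1 x.2) : CEIn X fun a => ∀ i < f a, p a i := by
  obtain ⟨r, hr, h⟩ := hp
  refine ⟨fun x => ∀ i < f x.1, ∃ m < x.2.1 + 1, r ((x.1, i), m, x.2.2.take m),
    PrimrecPred.forall_lt_of (by fun_prop) (PrimrecPred.exists_lt_of (by fun_prop)
      (hr.comp (by fun_prop))), fun a => ?_⟩
  constructor
  · intro ha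
    choose m hm using fun i (hi : i < f a) => (h (a, i)).1 (ha i hi)
    -- The sum serves only as a common bound for the finitely many witnesses.
    refine ⟨∑ i : Fin (f a), m i.1 i.2, fun i hi => ?_⟩
    have hle : m i hi ≤ ∑ i : Fin (f a), m i.1 i.2 :=
      Finset.single_le_sum (f := fun i : Fin (f a) => m i.1 i.2) (fun _ _ => Nat.zero_le _)
        (Finset.mem_univ ⟨i, hi⟩)
    refine ⟨m i hi, Nat.lt_succ_of_le hle, ?_⟩
    simpa [take_initSeg, hle] using hm i hi
  · rintro ⟨n, hn⟩ i hi
    obtain ⟨m, hm, hr⟩ := hn i hi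
    rw [take_initSeg X (by simpa using Nat.lt_succ_iff.1 hm)] at hr
    exact (h (a, i)).2 ⟨m, hr⟩

theorem mem {f : α → ℕ} (hf : Primrec f) : CEIn X fun a => f a ∈ X := by
  refine ⟨fun x => x.2.2[f x.1]? = some true, PrimrecPred.eq_of (by fun_prop) (by fun_prop),
    fun a => ?_⟩
  simp only [initSeg_getElem?_eq_some]
  exact ⟨fun h => ⟨f a + 1, by omega, by simpa⟩, fun ⟨_, _, h⟩ => by simpa using h⟩

theorem notMem {f : α → ℕ} (hf : Primrec f) : CEIn X fun a => f a ∉ X := by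
  refine ⟨fun x => x.2.2[f x.1]? = some false, PrimrecPred.eq_of (by fun_prop) (by fun_prop),
    fun a => ?_⟩
  simp only [initSeg_getElem?_eq_some]
  exact ⟨fun h => ⟨f a + 1, by omega, by simpa⟩, fun ⟨_, _, h⟩ => by simpa using h⟩

end CEIn

namespace DeltaIn

theorem of_iff {p q : α → Prop} (hp : DeltaIn X p) (h : ∀ a, q a ↔ p a) : DeltaIn X q := by
  rwa [show q = p from funext fun a => propext (h a)]

theorem of_primrec {p : α → Prop} (hp : PrimrecPred p) : DeltaIn X p :=
  ⟨.of_primrec hp, .of_primrec hp.not⟩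

theorem mem {f : α → ℕ} (hf : Primrec f) : DeltaIn X fun a => f a ∈ X := ⟨.mem hf, .notMem hf⟩

theorem comp {p : β → Prop} (hp : DeltaIn X p) {f : α → β} (hf : Primrec f) :
    DeltaIn X fun a => p (f a) := ⟨hp.1.comp hf, hp.2.comp hf⟩

theorem not {p : α → Prop} (hp : DeltaIn X p) : DeltaIn X fun a => ¬ p a :=
  ⟨hp.2, hp.1.of_iff fun _ => not_not⟩

theorem and {p q : α → Prop} (hp : DeltaIn X p) (hq : DeltaIn X q) :
    DeltaIn X fun a => p a ∧ q a :=
  ⟨hp.1.and hq.1, (hp.2.or hq.2).of_iff fun _ => not_and_or⟩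

theorem or {p q : α → Prop} (hp : DeltaIn X p) (hq : DeltaIn X q) :
    DeltaIn X fun a => p a ∨ q a :=
  ⟨hp.1.or hq.1, (hp.2.and hq.2).of_iff fun _ => not_or⟩

theorem imp {p q : α → Prop} (hp : DeltaIn X p) (hq : DeltaIn X q) :
    DeltaIn X fun a => p a → q a :=
  (hp.not.or hq).of_iff fun _ => imp_iff_not_or

theorem exists_lt {f : α → ℕ} {p : α → ℕ → Prop} (hf : Primrec f)
    (hp : DeltaIn X fun x : α × ℕ => p x.1 x.2) : DeltaIn X fun a => ∃ i < f a, p a i :=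
  ⟨.ex (.and (.of_primrec (PrimrecPred.lt_of (by fun_prop) (by fun_prop))) hp.1),
    (CEIn.forall_lt hf hp.2).of_iff fun _ => by push Not; rfl⟩

theorem forall_lt {f : α → ℕ} {p : α → ℕ → Prop} (hf : Primrec f)
    (hp : DeltaIn X fun x : α × ℕ => p x.1 x.2) : DeltaIn X fun a => ∀ i < f a, p a i :=
  (exists_lt (p := fun a i => ¬ p a i) hf hp.not).not.of_iff fun _ => by push Not; rfl

end DeltaIn

/-- Computable enumerability is transitive along Turing reducibility of the oracle. -/
theorem CEIn.trans {p : α → Prop} (hp : CEIn X p) (hX : DeltaIn Y (· ∈ X)) : CEIn Y p := by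
  obtain ⟨r, hr, h⟩ := hp
  -- Guess a segment of `X` and confirm each bit by a `Y`-enumeration of `X` or of its complement.
  have key : CEIn Y fun a => ∃ σ : List Bool, r (a, σ.length, σ) ∧
      ∀ i < σ.length, (σ[i]? = some true ∧ i ∈ X) ∨ (σ[i]? = some false ∧ i ∉ X) :=
    .ex (.and (.of_primrec (hr.comp (by fun_prop))) (.forall_lt (by fun_prop)
      (.or (.and (.of_primrec (.eq_of (by fun_prop) (by fun_prop))) (hX.1.comp (by fun_prop)))
        (.and (.of_primrec (.eq_of (by fun_prop) (by fun_prop))) (hX.2.comp (by fun_prop))))))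
  refine key.of_iff fun a => (h a).trans ⟨fun ⟨n, hn⟩ => ⟨initSeg X n, by simpa using hn, ?_⟩, ?_⟩
  · intro i hi
    simp only [length_initSeg] at hi
    by_cases hx : i ∈ X <;> simp only [initSeg_getElem?_eq_some] <;> simp [hi, hx]
  · rintro ⟨σ, hσ, h⟩
    refine ⟨σ.length, ?_⟩
    rwa [show initSeg X σ.length = σ from ?_]
    refine List.ext_getElem? fun i => ?_
    by_cases hi : i < σ.length
    · rcases h i hi with ⟨h1, h2⟩ | ⟨h1, h2⟩ <;>
        rw [h1, initSeg_getElem?_eq_some] <;> simp [hi, h2]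
    · rw [List.getElem?_eq_none (by simpa using hi), List.getElem?_eq_none (by simpa using hi)]

theorem DeltaIn.trans {p : α → Prop} (hp : DeltaIn X p) (hX : DeltaIn Y (· ∈ X)) : DeltaIn Y p :=
  ⟨hp.1.trans hX, hp.2.trans hX⟩

theorem DeltaIn.of_empty {p : α → Prop} (hp : DeltaIn ∅ p) : DeltaIn Y p :=
  hp.trans ((of_primrec (.eq_of (Primrec.const 0) (Primrec.const 1))).of_iff fun _ => by simp)

end CohLocks

namespace CohLocks

open Encodable

variable {α β : Type*} [Primcodable α] [Primcodable β] {X Y : Set ℕ}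

/-! ### Agreement with Turing reducibility -/

theorem CEIn.graph_of_recursiveIn {f : ℕ →. ℕ} (hf : Nat.RecursiveIn {charFn X} f) :
    CEIn X fun x : ℕ × ℕ => x.2 ∈ f x.1 := by
  induction hf with
  | zero =>
    exact (CEIn.of_primrec (.eq_of (f := fun x : ℕ × ℕ => x.2) (by fun_prop)
      (Primrec.const 0))).of_iff fun x => Part.mem_some_iff
  | succ =>
    exact (CEIn.of_primrec (.eq_of (f := fun x : ℕ × ℕ => x.2) (g := fun x => x.1 + 1)
      (by fun_prop) (by fun_prop))).of_iff fun x => Part.mem_some_iff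
  | left =>
    exact (CEIn.of_primrec (.eq_of (f := fun x : ℕ × ℕ => x.2) (g := fun x => x.1.unpair.1)
      (by fun_prop) (by fun_prop))).of_iff fun x => Part.mem_some_iff
  | right =>
    exact (CEIn.of_primrec (.eq_of (f := fun x : ℕ × ℕ => x.2) (g := fun x => x.1.unpair.2)
      (by fun_prop) (by fun_prop))).of_iff fun x => Part.mem_some_iff
  | oracle g hg =>
    rw [Set.mem_singleton_iff] at hg
    subst hg
    have h : CEIn X fun x : ℕ × ℕ => (x.1 ∈ X ∧ x.2 = 1) ∨ (x.1 ∉ X ∧ x.2 = 0) :=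
      .or (.and (.mem (by fun_prop)) (.of_primrec (.eq_of (by fun_prop) (by fun_prop))))
        (.and (.notMem (by fun_prop)) (.of_primrec (.eq_of (by fun_prop) (by fun_prop))))
    refine h.of_iff fun x => ?_
    by_cases hx : x.1 ∈ X <;> simp [charFn, hx]
  | @pair f h _ _ ihf ihh =>
    have key : CEIn X fun x : ℕ × ℕ => ∃ a b, (a ∈ f x.1 ∧ b ∈ h x.1) ∧ Nat.pair a b = x.2 :=
      .ex (.ex (.and (.and (ihf.comp (f := fun x : ((ℕ × ℕ) × ℕ) × ℕ => (x.1.1.1, x.1.2))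
          (by fun_prop))
        (ihh.comp (f := fun x : ((ℕ × ℕ) × ℕ) × ℕ => (x.1.1.1, x.2)) (by fun_prop)))
        (.of_primrec (.eq_of (by fun_prop) (by fun_prop)))))
    refine key.of_iff fun x => ?_
    simp [Seq.seq]
    grind
  | @comp f h _ _ ihf ihh =>
    have key : CEIn X fun x : ℕ × ℕ => ∃ a, a ∈ h x.1 ∧ x.2 ∈ f a :=
      .ex (.and (ihh.comp (f := fun x : (ℕ × ℕ) × ℕ => (x.1.1, x.2)) (by fun_prop))
        (ihf.comp (f := fun x : (ℕ × ℕ) × ℕ => (x.2, x.1.2)) (by fun_prop)))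
    exact key.of_iff fun x => Part.mem_bind_iff
  | @prec f h _ _ ihf ihh =>
    -- The witness for a primitive recursion is the list of its intermediate values.
    have key : CEIn X fun x : ℕ × ℕ => ∃ l : List ℕ, (∃ a, l[0]? = some a ∧ a ∈ f x.1.unpair.1) ∧
        (∀ i < x.1.unpair.2, ∃ u v, (l[i]? = some u ∧ l[i + 1]? = some v) ∧
          v ∈ h (Nat.pair x.1.unpair.1 (Nat.pair i u))) ∧ l[x.1.unpair.2]? = some x.2 :=
      .ex (.and (.ex (.and (.of_primrec (.eq_of (by fun_prop) (by fun_prop)))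
          (ihf.comp (f := fun x : ((ℕ × ℕ) × List ℕ) × ℕ => (x.1.1.1.unpair.1, x.2))
            (by fun_prop))))
        (.and (.forall_lt (by fun_prop) (.ex (.ex (.and (.and
          (.of_primrec (.eq_of (by fun_prop) (by fun_prop)))
          (.of_primrec (.eq_of (by fun_prop) (by fun_prop))))
          (ihh.comp (f := fun x : ((((ℕ × ℕ) × List ℕ) × ℕ) × ℕ) × ℕ =>
            (Nat.pair x.1.1.1.1.1.unpair.1 (Nat.pair x.1.1.2 x.1.2), x.2)) (by fun_prop))))))
          (.of_primrec (.eq_of (by fun_prop) (by fun_prop)))))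
    refine key.of_iff fun x => ?_
    obtain ⟨p, v⟩ := x
    simp only
    generalize p.unpair.1 = a
    generalize p.unpair.2 = n
    induction n generalizing v with
    | zero =>
      simp only [Nat.not_lt_zero, false_imp_iff, implies_true, true_and]
      exact ⟨fun h => ⟨[v], ⟨v, rfl, h⟩, rfl⟩, fun ⟨l, ⟨u, h1, h2⟩, h3⟩ => by
        rw [h1] at h3; cases h3; exact h2⟩
    | succ n ih =>
      simp only [Part.bind_eq_bind, Part.mem_bind_iff]
      constructor
      · rintro ⟨u, hu, hv⟩
        obtain ⟨l, h1, h2, h3⟩ := (ih u).1 hu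
        have hn : n < l.length := (List.getElem?_eq_some_iff.1 h3).1
        have hlen : (l.take (n + 1)).length = n + 1 := by simp; omega
        refine ⟨l.take (n + 1) ++ [v], ?_, ?_, ?_⟩
        · rw [List.getElem?_append_left (by omega)]
          simpa using h1
        · intro i hi
          rcases Nat.lt_succ_iff_lt_or_eq.1 hi with hi' | rfl
          · obtain ⟨u, w, ⟨h4, h5⟩, h6⟩ := h2 i hi'
            refine ⟨u, w, ⟨?_, ?_⟩, h6⟩
            · rw [List.getElem?_append_left (by omega), List.getElem?_take_of_lt (by omega)]
              exact h4
            · rw [List.getElem?_append_left (by omega), List.getElem?_take_of_lt (by omega)]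
              exact h5
          · refine ⟨u, v, ⟨?_, ?_⟩, hv⟩
            · rw [List.getElem?_append_left (by omega), List.getElem?_take_of_lt (by omega)]
              exact h3
            · rw [List.getElem?_append_right (by omega), hlen]
              simp
        · rw [List.getElem?_append_right (by omega), hlen]
          simp
      · rintro ⟨l, h1, h2, h3⟩
        obtain ⟨u, w, ⟨h4, h5⟩, h6⟩ := h2 n (by omega)
        rw [h3] at h5
        cases h5
        exact ⟨u, (ih u).2 ⟨l, h1, fun i hi => h2 i (by omega), h4⟩, h6⟩
  | @rfind f _ ihf =>
    have key : CEIn X fun x : ℕ × ℕ => 0 ∈ f (Nat.pair x.1 x.2) ∧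
        ∀ m < x.2, ∃ w, w ≠ 0 ∧ w ∈ f (Nat.pair x.1 m) :=
      .and (ihf.comp (f := fun x : ℕ × ℕ => (Nat.pair x.1 x.2, 0)) (by fun_prop))
        (.forall_lt (by fun_prop) (.ex (.and
          (.of_primrec (PrimrecPred.eq_of (by fun_prop) (by fun_prop)).not)
          (ihf.comp (f := fun x : ((ℕ × ℕ) × ℕ) × ℕ => (Nat.pair x.1.1.1 x.1.2, x.2))
            (by fun_prop)))))
    refine key.of_iff fun x => ?_
    refine Nat.mem_rfind.trans (and_congr ?_ (forall₂_congr fun m _ => ?_)) <;>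
      simp [and_comm]

theorem DeltaIn.of_setReducible {P : Set ℕ} (h : SetReducible P X) : DeltaIn X (· ∈ P) := by
  have h := CEIn.graph_of_recursiveIn (RecursiveIn.iff_nat.1 h)
  refine ⟨(h.comp (f := fun n : ℕ => (n, 1)) (by fun_prop)).of_iff fun n => ?_,
    (h.comp (f := fun n : ℕ => (n, 0)) (by fun_prop)).of_iff fun n => ?_⟩ <;>
  by_cases hn : n ∈ P <;> simp [charFn, hn]

theorem recursiveIn_comp {O : Set (ℕ →. ℕ)} {f : ℕ → ℕ} {g : ℕ →. ℕ} (hf : Nat.Primrec f)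
    (hg : Nat.RecursiveIn O g) : Nat.RecursiveIn O fun n => (g n).map f :=
  (Nat.RecursiveIn.comp hf.recursiveIn hg).of_eq fun _ => Part.bind_some_eq_map _ _

theorem recursiveIn_initSeg (X : Set ℕ) :
    Nat.RecursiveIn {charFn X} fun n => Part.some (encode (initSeg X n)) := by
  classical
  have hG : Primrec fun m : ℕ => encode
      (((decode m.unpair.1 : Option (List Bool)).getD []) ++ [decide (m.unpair.2 = 1)]) := by
    refine primrec_encode (primrec_append (Primrec.option_getD.comp (by fun_prop) (by fun_prop))
      (Primrec.list_cons.comp ?_ (Primrec.const [])))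
    exact (PrimrecPred.eq_of (by fun_prop) (by fun_prop)).decide
  have hI : Nat.RecursiveIn {charFn X} fun m => Part.some m.unpair.2.unpair.2 :=
    Nat.Primrec.recursiveIn (Primrec.nat_iff.1 (by fun_prop : Primrec
      fun m : ℕ => m.unpair.2.unpair.2))
  have hJ : Nat.RecursiveIn {charFn X} fun m => charFn X m.unpair.2.unpair.1 :=
    (Nat.RecursiveIn.comp (.oracle (charFn X) (Set.mem_singleton _)) (Nat.Primrec.recursiveIn (Primrec.nat_iff.1
      (by fun_prop : Primrec fun m : ℕ => m.unpair.2.unpair.1)))).of_eq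
      fun _ => Part.bind_some _ _
  have hP := Nat.RecursiveIn.prec (O := {charFn X})
    (Nat.Primrec.recursiveIn (Nat.Primrec.const (encode ([] : List Bool))))
    (recursiveIn_comp (Primrec.nat_iff.1 hG) (hI.pair hJ))
  refine (Nat.RecursiveIn.comp hP (Nat.Primrec.recursiveIn (Primrec.nat_iff.1
    (by fun_prop : Primrec fun m : ℕ => Nat.pair 0 m)))).of_eq fun n => ?_
  refine (Part.bind_some _ _).trans ?_
  simp only [Part.bind_eq_bind, Nat.unpair_pair]
  induction n with
  | zero => rfl
  | succ n ih =>
    refine (congrArg (fun z => Part.bind z _) ih).trans ((Part.bind_some _ _).trans ?_)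
    by_cases hn : n ∈ X <;> simp [charFn, hn, Seq.seq, initSeg, List.range_succ]

/-- Post's theorem. It lets reducibility be proved below from closure properties of enumerability
alone. Conversely, one searches with the oracle for the first stage at which `P` or its complement
is confirmed. -/
theorem setReducible_iff {P : Set ℕ} : SetReducible P X ↔ DeltaIn X (· ∈ P) := by
  refine ⟨DeltaIn.of_setReducible, fun ⟨⟨r, hr, h⟩, ⟨s, hs, h'⟩⟩ => RecursiveIn.iff_nat.2 ?_⟩
  classical
  let t : ℕ → ℕ × ℕ × List Bool := fun m => (m.unpair.1.unpair.1, m.unpair.1.unpair.2,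
    (decode m.unpair.2 : Option (List Bool)).getD [])
  have ht : Primrec t := by
    refine Primrec.pair (by fun_prop) (Primrec.pair (by fun_prop) ?_)
    exact Primrec.option_getD.comp (by fun_prop) (by fun_prop)
  -- `rfind` looks for the value `0`, so `0` signals success here.
  have hK : Primrec fun m : ℕ => if r (t m) ∨ s (t m) then 0 else 1 :=
    Primrec.ite ((hr.comp ht).or (hs.comp ht)) (by fun_prop) (by fun_prop)
  have hK' : Primrec fun m : ℕ => if r (t m) then 1 else 0 :=
    Primrec.ite (hr.comp ht) (by fun_prop) (by fun_prop)
  have hid : Nat.RecursiveIn {charFn X} fun m => Part.some m :=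
    Nat.Primrec.recursiveIn Nat.Primrec.id
  have hseg : Nat.RecursiveIn {charFn X}
      fun m => Part.some (Nat.pair m (encode (initSeg X m.unpair.2))) :=
    (hid.pair (Nat.RecursiveIn.comp (recursiveIn_initSeg X) .right)).of_eq fun m => by
      simp [Seq.seq]
  have hfind := Nat.RecursiveIn.rfind (recursiveIn_comp (Primrec.nat_iff.1 hK) hseg)
  have hex : ∀ x, ∃ n, r (x, n, initSeg X n) ∨ s (x, n, initSeg X n) := fun x => by
    by_cases hx : x ∈ P
    · exact ((h x).1 hx).imp fun _ => Or.inl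
    · exact ((h' x).1 hx).imp fun _ => Or.inr
  have hout := recursiveIn_comp (Primrec.nat_iff.1 hK') (Nat.RecursiveIn.comp hseg
    (hid.pair hfind))
  refine hout.of_eq fun x => ?_
  have h1 : ∀ n, t (Nat.pair (Nat.pair x n) (encode (initSeg X n))) = (x, n, initSeg X n) := by
    intro n; simp [t]
  have h2 : (Nat.rfind fun n => (fun m => decide (m = 0)) <$> (Part.some (Nat.pair (Nat.pair x n)
      (encode (initSeg X (Nat.pair x n).unpair.2)))).map fun m => if r (t m) ∨ s (t m) then 0 else 1)
      = Part.some (Nat.find (hex x)) := by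
    refine Part.eq_some_iff.2 (Nat.mem_rfind.2 ?_)
    simp only [Nat.unpair_pair, Part.map_some, Part.map_eq_map, h1, Part.mem_some_iff]
    refine ⟨?_, fun {m} hm => ?_⟩
    · simp [Nat.find_spec (hex x)]
    · simpa using Nat.find_min (hex x) hm
  rw [h2]
  simp only [Seq.seq, Part.map_eq_map, Part.map_some, Part.bind_some, Part.bind_eq_bind,
    Nat.unpair_pair, h1, charFn]
  congr 1
  have h3 := Nat.find_spec (hex x)
  refine if_congr ⟨fun hx => (h x).2 ⟨_, hx⟩, fun hx => h3.resolve_right fun hs =>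
    (h' x).2 ⟨_, hs⟩ hx⟩ rfl rfl

theorem DeltaIn.image_encode {T : Set α} (hT : DeltaIn X (· ∈ T)) :
    SetReducible (encode '' T) X := by
  refine setReducible_iff.2 ⟨?_, ?_⟩
  · have h : CEIn X fun n : ℕ => ∃ a : α, a ∈ T ∧ encode a = n :=
      .ex (.and (hT.1.comp (by fun_prop)) (.of_primrec (.eq_of (by fun_prop) (by fun_prop))))
    exact h
  -- Numbers that code nothing also lie in the complement; `decode₂` rejects exactly these.
  · have h : CEIn X fun n : ℕ => decode₂ α n = none ∨ ∃ a : α, a ∉ T ∧ encode a = n :=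
      .or (.of_primrec (.eq_of Primrec.decode₂ (by fun_prop)))
        (.ex (.and (hT.2.comp (by fun_prop)) (.of_primrec (.eq_of (by fun_prop) (by fun_prop)))))
    refine h.of_iff fun n => ?_
    cases hn : decode₂ α n with
    | none => simpa using fun x _ hx => by simp [← hx] at hn
    | some a =>
      obtain rfl := mem_decode₂.1 hn
      simp

/-- With the segment length given by `g`, only the stage `g a` is consulted, so the negation is
enumerable as well. -/
theorem DeltaIn.matrix {r : β × ℕ × List Bool → Prop} (hr : PrimrecPred r) {f : α → β}
    {g : α → ℕ} (hf : Primrec f) (hg : Primrec g) :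
    DeltaIn X fun a => r (f a, g a, initSeg X (g a)) :=
  ⟨⟨fun x => x.2.1 = g x.1 ∧ r (f x.1, x.2.1, x.2.2),
      (PrimrecPred.eq_of (by fun_prop) (by fun_prop)).and (hr.comp (by fun_prop)),
      fun a => by simp⟩,
    ⟨fun x => x.2.1 = g x.1 ∧ ¬ r (f x.1, x.2.1, x.2.2),
      (PrimrecPred.eq_of (by fun_prop) (by fun_prop)).and (hr.comp (by fun_prop)).not,
      fun a => by simp⟩⟩

/-! ### The jump -/

open Nat.Partrec (Code)

theorem exists_code_dom_iff {r : β → Prop} (hr : PrimrecPred r) :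
    ∃ c : Code, ∀ b, (c.eval (encode b)).Dom ↔ r b := by
  classical
  have h : Primrec fun m : ℕ => if ∃ b : β, decode m = some b ∧ r b then some 0 else none :=
    Primrec.ite (PrimrecPred.exists_eq_some (by fun_prop) (hr.comp (by fun_prop)))
      (by fun_prop) (by fun_prop)
  obtain ⟨c, hc⟩ := Code.exists_code.1 (Partrec.nat_iff.1 h.to_comp.ofOption)
  refine ⟨c, fun b => ?_⟩
  simp only [hc, encodek, Option.some.injEq, exists_eq_left']
  split_ifs with h <;> simp [h]

theorem CEIn.enumSet : CEIn X fun x : ℕ × ℕ => x.2 ∈ enumSet x.1 X := by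
  have h : CEIn X fun x : ℕ × ℕ => ∃ k n, ((Code.evaln k (Denumerable.ofNat Code x.1)
      (encode (x.2, initSeg X n))).isSome = true) := by
    refine .ex ⟨fun y => (Code.evaln y.1.2 (Denumerable.ofNat Code y.1.1.1)
      (encode (y.1.1.2, y.2.2))).isSome = true, PrimrecPred.eq_of ?_ (by fun_prop), fun a => Iff.rfl⟩
    refine Primrec.option_isSome.comp (Code.primrec_evaln.comp (f := fun a : (ℕ × Code) × ℕ =>
      Code.evaln a.1.1 a.1.2 a.2) (g := fun y : ((ℕ × ℕ) × ℕ) × ℕ × List Bool =>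
      ((y.1.2, Denumerable.ofNat Code y.1.1.1), encode (y.1.1.2, y.2.2))) ?_)
    have := (Primrec.ofNat Code).comp
      (by fun_prop : Primrec fun y : ((ℕ × ℕ) × ℕ) × ℕ × List Bool => y.1.1.1)
    fun_prop
  refine h.of_iff fun x => ?_
  simp only [CohLocks.enumSet, Set.mem_ofPred_eq, Part.dom_iff_mem, Code.evaln_complete,
    Option.isSome_iff_exists, Option.mem_def]
  grind

theorem CEIn.exists_enumSet {p : ℕ → Prop} (hp : CEIn X p) :
    ∃ e, ∀ x, x ∈ CohLocks.enumSet e X ↔ p x := by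
  obtain ⟨r, hr, h⟩ := hp
  -- Programs in `enumSet` see the segment but not the stage, which is recovered as the segment's
  -- length.
  obtain ⟨c, hc⟩ := exists_code_dom_iff (r := fun b : ℕ × List Bool => r (b.1, b.2.length, b.2))
    (hr.comp (by fun_prop))
  refine ⟨encode c, fun x => ?_⟩
  rw [h]
  refine exists_congr fun n => ?_
  have := hc (x, initSeg X n)
  rw [length_initSeg] at this
  simpa [-encode_prod_val] using this

theorem CEIn.jump (X : Set ℕ) : CEIn X (· ∈ jump X) :=
  CEIn.enumSet.comp (f := fun e : ℕ => (e, e)) (by fun_prop)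

/-- Many-one completeness of the jump, by the s-m-n theorem: the parameter `a` is curried into a
program that ignores its own index. -/
theorem CEIn.exists_primrec_jump {p : α → Prop} (hp : CEIn X p) :
    ∃ f : α → ℕ, Primrec f ∧ ∀ a, p a ↔ f a ∈ CohLocks.jump X := by
  obtain ⟨r, hr, h⟩ := hp
  obtain ⟨c, hc⟩ := exists_code_dom_iff
    (r := fun b : α × ℕ × List Bool => r (b.1, b.2.2.length, b.2.2)) (hr.comp (by fun_prop))
  refine ⟨fun a => encode (Code.curry c (encode a)),
    primrec_encode (Code.primrec₂_curry.comp (by fun_prop) (by fun_prop)), fun a => ?_⟩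
  rw [h]
  simp only [CohLocks.jump, CohLocks.enumSet, Set.mem_ofPred_eq, Denumerable.ofNat_encode,
    Code.eval_curry]
  refine exists_congr fun n => ?_
  have := hc (a, encode (Code.curry c (encode a)), initSeg X n)
  rw [length_initSeg] at this
  exact this.symm

theorem CEIn.deltaIn_jump {p : α → Prop} (hp : CEIn X p) : DeltaIn (CohLocks.jump X) p := by
  obtain ⟨f, hf, h⟩ := hp.exists_primrec_jump
  exact (DeltaIn.mem hf).of_iff h

theorem DeltaIn.jump {p : α → Prop} (hp : DeltaIn X p) : DeltaIn (CohLocks.jump X) p :=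
  hp.1.deltaIn_jump

theorem DeltaIn.jump_mono (h : DeltaIn Y (· ∈ X)) :
    DeltaIn (CohLocks.jump Y) (· ∈ CohLocks.jump X) :=
  ((CEIn.jump X).trans h).deltaIn_jump

/-- `Σ₂` normal form. -/
theorem CEIn.exists_not_of_jump {p : α → Prop} (hp : CEIn (CohLocks.jump Y) p) :
    ∃ q : α × ℕ → Prop, CEIn Y q ∧ ∀ a, p a ↔ ∃ m, ¬ q (a, m) := by
  obtain ⟨r, hr, h⟩ := hp
  obtain ⟨s, hs, hJ⟩ := CEIn.jump Y
  -- `q` says that `(σ, K)` is a bad certificate. A good one is a segment `σ` of the jump that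
  -- satisfies `r` and whose ones are all confirmed before stage `K`. Badness is enumerable in `Y`.
  let q : α × List Bool × ℕ → Prop := fun x => ¬ r (x.1, x.2.1.length, x.2.1) ∨
    ∃ i, (x.2.1[i]? = some true ∧ ∀ k < x.2.2, ¬ s (i, k, initSeg Y k)) ∨
      (x.2.1[i]? = some false ∧ i ∈ CohLocks.jump Y)
  have hq : CEIn Y q :=
    .or (.of_primrec (PrimrecPred.not (hr.comp (by fun_prop)))) (.ex (.or
      (.and (.of_primrec (.eq_of (by fun_prop) (by fun_prop))) (.forall_lt (by fun_prop)
        (DeltaIn.matrix hs (by fun_prop) (by fun_prop)).2))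
      (.and (.of_primrec (.eq_of (by fun_prop) (by fun_prop)))
        ((CEIn.jump Y).comp (by fun_prop)))))
  have hqp : ∀ a, p a ↔ ∃ b, ¬ q (a, b) := by
    refine fun a => ⟨fun ha => ?_, fun ⟨⟨σ, K⟩, hb⟩ => ?_⟩
    · obtain ⟨n, hn⟩ := (h a).1 ha
      have hbound : ∃ K, ∀ i < n, i ∈ CohLocks.jump Y → ∃ k < K, s (i, k, initSeg Y k) := by
        clear hn
        induction n with
        | zero => exact ⟨0, by simp⟩
        | succ n ih =>
          obtain ⟨K, hK⟩ := ih
          by_cases hi : n ∈ CohLocks.jump Y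
          · obtain ⟨k, hk⟩ := (hJ n).1 hi
            refine ⟨max K (k + 1), fun i hin hi => ?_⟩
            rcases Nat.lt_succ_iff_lt_or_eq.1 hin with h' | rfl
            · obtain ⟨k', h1, h2⟩ := hK i h' hi
              exact ⟨k', lt_max_of_lt_left h1, h2⟩
            · exact ⟨k, lt_max_of_lt_right (Nat.lt_succ_self k), hk⟩
          · refine ⟨K, fun i hin hi' => hK i ?_ hi'⟩
            rcases Nat.lt_succ_iff_lt_or_eq.1 hin with h' | rfl
            · exact h'
            · exact absurd hi' hi
      obtain ⟨K, hK⟩ := hbound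
      refine ⟨(initSeg (CohLocks.jump Y) n, K), ?_⟩
      rintro (h1 | ⟨i, ⟨h1, h2⟩ | ⟨h1, h2⟩⟩)
      · simp only [length_initSeg] at h1
        exact h1 hn
      · obtain ⟨hin, hi⟩ := (initSeg_getElem?_eq_some _).1 h1
        obtain ⟨k, hk, hs⟩ := hK i hin (hi.2 rfl)
        exact h2 k hk hs
      · obtain ⟨hin, hi⟩ := (initSeg_getElem?_eq_some _).1 h1
        simp [h2] at hi
    · simp only [q, not_or, not_not, not_exists] at hb
      refine (h a).2 ⟨σ.length, ?_⟩
      rw [show initSeg (CohLocks.jump Y) σ.length = σ from ?_]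
      · exact hb.1
      refine List.ext_getElem? fun i => ?_
      by_cases hi : i < σ.length
      · have h2 := hb.2 i
        rw [List.getElem?_eq_getElem hi] at h2 ⊢
        rw [initSeg_getElem?_eq_some]
        refine ⟨hi, ?_⟩
        cases hv : σ[i] with
        | true =>
          have h3 := h2.1
          simp only [hv, true_and, not_forall, not_not] at h3
          obtain ⟨k, -, hk⟩ := h3
          simpa using (hJ i).2 ⟨k, hk⟩
        | false =>
          have h3 := h2.2
          simp only [hv, true_and] at h3
          simpa using h3
      · rw [List.getElem?_eq_none (by simpa using hi), List.getElem?_eq_none (by simpa using hi)]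
  -- Numbers coding no certificate are declared bad, so that they are never witnesses.
  refine ⟨fun x => decode x.2 = (none : Option (List Bool × ℕ)) ∨
    ∃ b, decode x.2 = some b ∧ q (x.1, b), .or (.of_primrec (.eq_of (by fun_prop) (by fun_prop)))
    (.ex (.and (.of_primrec (.eq_of (by fun_prop) (by fun_prop))) (hq.comp (by fun_prop)))),
    fun a => (hqp a).trans ⟨fun ⟨b, hb⟩ => ⟨encode b, by simpa using hb⟩, fun ⟨m, hm⟩ => ?_⟩⟩
  cases hd : (decode m : Option (List Bool × ℕ)) with
  | none => exact absurd (Or.inl hd) hm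
  | some b => exact ⟨b, fun hb => hm (Or.inr ⟨b, hd, hb⟩)⟩

/-! ### Reduction, inseparable pairs and trees -/

/-- The reduction property of the computably enumerable predicates. -/
theorem CEIn.reduction {p q : α → Prop} (hp : CEIn X p) (hq : CEIn X q) :
    ∃ p' q' : α → Prop, CEIn X p' ∧ CEIn X q' ∧ (∀ a, p' a → p a) ∧ (∀ a, q' a → q a) ∧
      (∀ a, ¬ (p' a ∧ q' a)) ∧ ∀ a, p a ∨ q a → p' a ∨ q' a := by
  classical
  obtain ⟨r, hr, h⟩ := hp
  obtain ⟨s, hs, h'⟩ := hq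
  -- Each `a` goes to the side that confirms it first; the bound `n + 1` on the second side awards
  -- ties to the first.
  refine ⟨fun a => ∃ n, r (a, n, initSeg X n) ∧ ∀ m < n, ¬ s (a, m, initSeg X m),
    fun a => ∃ n, s (a, n, initSeg X n) ∧ ∀ m < n + 1, ¬ r (a, m, initSeg X m),
    .ex (.and (DeltaIn.matrix hr (by fun_prop) (by fun_prop)).1 (.forall_lt (by fun_prop)
      (DeltaIn.matrix hs (by fun_prop) (by fun_prop)).2)),
    .ex (.and (DeltaIn.matrix hs (by fun_prop) (by fun_prop)).1 (.forall_lt (by fun_prop)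
      (DeltaIn.matrix hr (by fun_prop) (by fun_prop)).2)),
    fun a ⟨n, hn, _⟩ => (h a).2 ⟨n, hn⟩, fun a ⟨n, hn, _⟩ => (h' a).2 ⟨n, hn⟩, ?_, ?_⟩
  · rintro a ⟨⟨n, h1, h2⟩, m, h3, h4⟩
    rcases lt_or_ge m n with hmn | hmn
    · exact h2 m hmn h3
    · exact h4 n (by omega) h1
  · intro a ha
    have hex : ∃ n, r (a, n, initSeg X n) ∨ s (a, n, initSeg X n) := by
      rcases ha with ha | ha
      · exact ((h a).1 ha).imp fun _ => Or.inl
      · exact ((h' a).1 ha).imp fun _ => Or.inr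
    have hmin := fun m (hm : m < Nat.find hex) => not_or.1 (Nat.find_min hex hm)
    by_cases h1 : r (a, Nat.find hex, initSeg X (Nat.find hex))
    · exact Or.inl ⟨_, h1, fun m hm => (hmin m hm).2⟩
    · refine Or.inr ⟨_, (Nat.find_spec hex).resolve_left h1, fun m hm => ?_⟩
      rcases Nat.lt_succ_iff_lt_or_eq.1 hm with hm | rfl
      · exact (hmin m hm).1
      · exact h1

/-- There are disjoint sets, computably enumerable in `X`, that no `X`-computable set separates. -/
theorem exists_inseparable (X : Set ℕ) : ∃ A B : ℕ → Prop, CEIn X A ∧ CEIn X B ∧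
    (∀ e, ¬ (A e ∧ B e)) ∧
    ∀ F : ℕ → Prop, DeltaIn X F → ∃ e, (A e ∧ F e) ∨ (B e ∧ ¬ F e) := by
  -- Diagonalization: `⟨a, b⟩` is offered to `A` by `W_a` and to `B` by `W_b`. If `W_a` is `F` and
  -- `W_b` its complement, exactly one offer is made, and it is the wrong one for a separator.
  obtain ⟨A, B, hA, hB, hA', hB', hd, hc⟩ := CEIn.reduction
    (CEIn.enumSet (X := X).comp (f := fun c : ℕ => (c.unpair.1, c)) (by fun_prop))
    (CEIn.enumSet (X := X).comp (f := fun c : ℕ => (c.unpair.2, c)) (by fun_prop))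
  refine ⟨A, B, hA, hB, hd, fun F hF => ?_⟩
  obtain ⟨a, ha⟩ := hF.1.exists_enumSet
  obtain ⟨b, hb⟩ := hF.2.exists_enumSet
  have hA' := hA' (Nat.pair a b)
  have hB' := hB' (Nat.pair a b)
  have hc := hc (Nat.pair a b)
  simp only [Nat.unpair_pair, ha, hb] at hA' hB' hc
  refine ⟨Nat.pair a b, ?_⟩
  tauto

/-- The separating sets of a disjoint pair of sets that are computably enumerable in `X` contain
the paths through an infinite `X`-computable tree. -/
theorem exists_tree_of_disjoint {A B : ℕ → Prop} (hA : CEIn X A) (hB : CEIn X B)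
    (hd : ∀ e, ¬ (A e ∧ B e)) : ∃ T : Set (List Bool), IsBinaryTree T ∧ T.Infinite ∧
      DeltaIn X (· ∈ T) ∧
      ∀ P : Set ℕ, (∀ n, initSeg P n ∈ T) → ∀ e, (A e → e ∉ P) ∧ (B e → e ∈ P) := by
  obtain ⟨r, hr, hA⟩ := hA
  obtain ⟨s, hs, hB⟩ := hB
  -- A string obeys only the enumerations seen before stage `σ.length`. This makes `T` decidable in
  -- `X`, and a path still meets every constraint eventually.
  let T : Set (List Bool) := {σ | ∀ e < σ.length, ∀ n < σ.length,
    (r (e, n, initSeg X n) → σ[e]? = some false) ∧ (s (e, n, initSeg X n) → σ[e]? = some true)}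
  refine ⟨T, ?_, ?_, ?_, ?_⟩
  · rintro σ τ hτ ⟨t, rfl⟩ e he n hn
    have h := hτ e (by simp; omega) n (by simp; omega)
    rwa [List.getElem?_append_left he] at h
  · refine Set.infinite_of_injective_forall_mem (f := fun n => initSeg {e | B e} n)
      (fun m n h => by simpa using congrArg List.length h) fun N e he n hn => ⟨fun h => ?_, fun h => ?_⟩
    · rw [initSeg_getElem?_eq_some]
      exact ⟨by simpa using he, by simpa using fun hb => hd e ⟨(hA e).2 ⟨n, h⟩, hb⟩⟩
    · rw [initSeg_getElem?_eq_some]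
      exact ⟨by simpa using he, by simpa using (hB e).2 ⟨n, h⟩⟩
  · exact .forall_lt (by fun_prop) (.forall_lt (by fun_prop) (.and
      (.imp (.matrix hr (by fun_prop) (by fun_prop))
        (.of_primrec (.eq_of (by fun_prop) (by fun_prop))))
      (.imp (.matrix hs (by fun_prop) (by fun_prop))
        (.of_primrec (.eq_of (by fun_prop) (by fun_prop))))))
  · refine fun P hP e => ⟨fun h => ?_, fun h => ?_⟩
    · obtain ⟨n, hn⟩ := (hA e).1 h
      have := (hP (max e n + 1) e (by simp) n (by simp)).1 hn
      rw [initSeg_getElem?_eq_some] at this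
      simpa using this.2
    · obtain ⟨n, hn⟩ := (hB e).1 h
      have := (hP (max e n + 1) e (by simp) n (by simp)).2 hn
      rw [initSeg_getElem?_eq_some] at this
      simpa using this.2

/-! ### Joins -/

@[simp] theorem two_mul_mem_join {A B : Set ℕ} {n : ℕ} : 2 * n ∈ join A B ↔ n ∈ A := by
  refine ⟨fun ⟨m, h⟩ => ?_, fun h => ⟨n, Or.inl ⟨rfl, h⟩⟩⟩
  rcases h with ⟨h, hm⟩ | ⟨h, -⟩
  · rwa [show n = m by omega]
  · omega

@[simp] theorem two_mul_add_one_mem_join {A B : Set ℕ} {n : ℕ} :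
    2 * n + 1 ∈ join A B ↔ n ∈ B := by
  refine ⟨fun ⟨m, h⟩ => ?_, fun h => ⟨n, Or.inr ⟨rfl, h⟩⟩⟩
  rcases h with ⟨h, -⟩ | ⟨h, hm⟩
  · omega
  · rwa [show n = m by omega]

theorem deltaIn_join_left (A B : Set ℕ) : DeltaIn (join A B) (· ∈ A) :=
  (DeltaIn.mem (f := fun n : ℕ => 2 * n) (by fun_prop)).of_iff fun _ => two_mul_mem_join.symm

theorem deltaIn_join_right (A B : Set ℕ) : DeltaIn (join A B) (· ∈ B) :=
  (DeltaIn.mem (f := fun n : ℕ => 2 * n + 1) (by fun_prop)).of_iff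
    fun _ => two_mul_add_one_mem_join.symm

theorem DeltaIn.join {A B : Set ℕ} (hA : DeltaIn X (· ∈ A)) (hB : DeltaIn X (· ∈ B)) :
    DeltaIn X (· ∈ join A B) := by
  have h : DeltaIn X fun m : ℕ => ∃ n < m + 1, (m = 2 * n ∧ n ∈ A) ∨ (m = 2 * n + 1 ∧ n ∈ B) :=
    .exists_lt (by fun_prop) (.or
      (.and (.of_primrec (.eq_of (by fun_prop) (by fun_prop))) (hA.comp (by fun_prop)))
      (.and (.of_primrec (.eq_of (by fun_prop) (by fun_prop))) (hB.comp (by fun_prop))))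
  refine h.of_iff fun m => ⟨fun ⟨n, hn⟩ => ⟨n, by omega, hn⟩, fun ⟨n, _, hn⟩ => ⟨n, hn⟩⟩

end CohLocks

namespace CohLocks

open Encodable

variable {X : Set ℕ}

/-! ### Extension of conditions -/

/-- The lists of columns that underlie the conditions. -/
abbrev Columns := List (List Bool × Option Bool)

/-- Extension of conditions, on the underlying lists of columns. -/
def Extends (q p : Columns) : Prop := (⟨q⟩ : LockCondition) ≤ ⟨p⟩

theorem Extends.trans {p q r : Columns} (hrq : Extends r q) (hqp : Extends q p) : Extends r p :=
  le_trans (α := LockCondition) hrq hqp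

/-- Writing the new string as `σ ++ t` exhibits extension as enumerable. For a locked column, `a`
itself is the required value of `t[x]?`. -/
theorem extends_iff {p q : Columns} : Extends q p ↔ p.length ≤ q.length ∧
    ∀ i < p.length, ∃ σ a, p[i]? = some (σ, a) ∧ ∃ t, q[i]? = some (σ ++ t, a) ∧
      (a = none ∨ ∀ x < t.length, t[x]? = a) := by
  refine and_congr_right fun _ => ⟨fun h i hi => ?_, fun h i σ a hp => ?_⟩
  · obtain ⟨⟨σ, a⟩, hp⟩ : ∃ c, p[i]? = some c := ⟨p[i], by simp [hi]⟩
    obtain ⟨_, hq, ⟨t, rfl⟩, hx⟩ := h i σ a hp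
    refine ⟨σ, a, hp, t, hq, ?_⟩
    cases a with
    | none => exact Or.inl rfl
    | some b =>
      refine Or.inr fun x hxt => ?_
      have := hx b rfl (σ.length + x) (by omega) (by simpa using hxt)
      rwa [List.getElem?_append_right (by omega), Nat.add_sub_cancel_left] at this
  · obtain ⟨σ', a', hp', t, hq, hx⟩ := h i (List.getElem?_eq_some_iff.1 hp).1
    obtain ⟨rfl, rfl⟩ : σ' = σ ∧ a' = a := by simpa [hp] using hp'.symm
    refine ⟨_, hq, List.prefix_append _ _, fun b hb x h1 h2 => ?_⟩
    subst hb
    rw [List.getElem?_append_right h1]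
    exact hx.resolve_left (by simp) _ (by simp at h2; omega)

theorem ceIn_extends : CEIn X fun x : Columns × Columns => Extends x.1 x.2 := by
  have h : CEIn X fun x : Columns × Columns => x.2.length ≤ x.1.length ∧
      ∀ i < x.2.length, ∃ σ a, x.2[i]? = some (σ, a) ∧ ∃ t, x.1[i]? = some (σ ++ t, a) ∧
        (a = none ∨ ∀ j < t.length, t[j]? = a) :=
    .and (.of_primrec (.le_of (by fun_prop) (by fun_prop))) (.forall_lt (by fun_prop)
      (.ex (.ex (.and (.of_primrec (.eq_of (by fun_prop) (by fun_prop)))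
        (.ex (.and (.of_primrec (.eq_of (by fun_prop) (by fun_prop)))
          (.or (.of_primrec (.eq_of (by fun_prop) (by fun_prop)))
            (.forall_lt (by fun_prop) (.of_primrec (.eq_of (by fun_prop) (by fun_prop)))))))))))
  exact h.of_iff fun x => extends_iff

/-- An extension of `p` with at least `n` columns of length at least `n`. -/
def grow (p : Columns) (n : ℕ) : Columns :=
  -- The padding respects the locks. Unlocked columns receive ones, which is what supplies common
  -- elements of these columns.
  p.map (fun c => (c.1 ++ List.replicate n (c.2.getD true), c.2)) ++
    List.replicate n (List.replicate n true, none)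

theorem grow_extends (p : Columns) (n : ℕ) : Extends (grow p n) p := by
  refine extends_iff.2 ⟨by simp [grow], fun i hi => ⟨p[i].1, p[i].2, by simp [hi],
    List.replicate n (p[i].2.getD true), ?_, ?_⟩⟩
  · rw [grow, List.getElem?_append_left (by simpa)]
    simp [hi]
  · cases h : p[i].2 <;> simp +contextual

theorem grow_getElem? (p : Columns) {i n : ℕ} (hi : i < n) : ∃ σ a,
    (grow p n)[i]? = some (σ, a) ∧ n ≤ σ.length ∧
      (∀ x < n, (∀ c ∈ p, c.1.length ≤ x) → a = none → σ[x]? = some true) := by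
  by_cases h : i < p.length
  · refine ⟨p[i].1 ++ List.replicate n (p[i].2.getD true), p[i].2, ?_, by simp, ?_⟩
    · rw [grow, List.getElem?_append_left (by simpa)]
      simp [h]
    · intro x hx hp ha
      rw [List.getElem?_append_right (hp _ (List.getElem_mem h)), ha,
        List.getElem?_replicate_of_lt (by omega)]
      rfl
  · refine ⟨List.replicate n true, none, ?_, by simp, fun x hx _ _ => by simp [hx]⟩
    rw [grow, List.getElem?_append_right (by simpa using h),
      List.getElem?_replicate_of_lt (by omega)]

/-! ### Forcing -/

/-- The condition `p` decides that the truth value of `j ∈ R ⊕ U` is `b`. -/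
def Forces (p : Columns) (j : ℕ) (b : Bool) : Prop :=
  (∃ m, j = 2 * m ∧ ∃ ρ a, p[m.unpair.1]? = some (ρ, a) ∧ ρ[m.unpair.2]? = some b) ∨
    ∃ m, j = 2 * m + 1 ∧ ∃ ρ a, p[m]? = some (ρ, a) ∧ b = a.isNone

/-- The condition `p` decides that `σ` is an initial segment of `R ⊕ U`. -/
def ForcesSeg (p : Columns) (σ : List Bool) : Prop :=
  ∀ j < σ.length, ∃ b, σ[j]? = some b ∧ Forces p j b

theorem ceIn_forces : CEIn X fun x : Columns × ℕ × Bool => Forces x.1 x.2.1 x.2.2 :=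
  .or (.ex (.and (.of_primrec (.eq_of (by fun_prop) (by fun_prop))) (.ex (.ex (.and
      (.of_primrec (.eq_of (by fun_prop) (by fun_prop)))
      (.of_primrec (.eq_of (by fun_prop) (by fun_prop))))))))
    (.ex (.and (.of_primrec (.eq_of (by fun_prop) (by fun_prop))) (.ex (.ex (.and
      (.of_primrec (.eq_of (by fun_prop) (by fun_prop)))
      (.of_primrec (.eq_of (by fun_prop) (by fun_prop))))))))

theorem ceIn_forcesSeg : CEIn X fun x : Columns × List Bool => ForcesSeg x.1 x.2 :=
  .forall_lt (by fun_prop) (.ex (.and (.of_primrec (.eq_of (by fun_prop) (by fun_prop)))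
    (ceIn_forces.comp (f := fun x : ((Columns × List Bool) × ℕ) × Bool =>
      (x.1.1.1, x.1.2, x.2)) (by fun_prop))))

theorem Forces.mono {p q : Columns} (h : Extends q p) {j : ℕ} {b : Bool} (hp : Forces p j b) :
    Forces q j b := by
  rcases hp with ⟨m, rfl, ρ, a, h1, h2⟩ | ⟨m, rfl, ρ, a, h1, h2⟩
  · obtain ⟨_, h3, ⟨t, rfl⟩, -⟩ := h.2 _ _ _ h1
    refine Or.inl ⟨m, rfl, _, a, h3, ?_⟩
    rw [List.getElem?_append_left (List.getElem?_eq_some_iff.1 h2).1]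
    exact h2
  · obtain ⟨τ, h3, -⟩ := h.2 _ _ _ h1
    exact Or.inr ⟨m, rfl, τ, a, h3, h2⟩

theorem ForcesSeg.mono {p q : Columns} (h : Extends q p) {σ : List Bool} (hp : ForcesSeg p σ) :
    ForcesSeg q σ := fun j hj => (hp j hj).imp fun _ hb => ⟨hb.1, hb.2.mono h⟩

theorem exists_forces_grow (p : Columns) {j n : ℕ} (hj : j < n) : ∃ b, Forces (grow p n) j b := by
  obtain ⟨m, rfl | rfl⟩ := Nat.even_or_odd' j
  · have h1 := Nat.unpair_left_le m
    have h2 := Nat.unpair_right_le m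
    obtain ⟨σ, a, h3, h4, -⟩ := grow_getElem? p (show m.unpair.1 < n by omega)
    exact ⟨σ[m.unpair.2], Or.inl ⟨m, rfl, σ, a, h3, List.getElem?_eq_getElem (by omega)⟩⟩
  · obtain ⟨σ, a, h3, -⟩ := grow_getElem? p (show m < n by omega)
    exact ⟨a.isNone, Or.inr ⟨m, rfl, σ, a, h3, rfl⟩⟩

/-! ### Generic filters -/

variable {G : Order.PFilter LockCondition} {n : ℕ}

theorem IsGenericAtLevel.exists_mem (hG : IsGenericAtLevel n G) {D : Columns → Prop}
    (hD : DeltaIn (jump^[n] ∅) D) (hd : ∀ p, ∃ q, Extends q p ∧ D q) : ∃ p ∈ G, D p.columns := by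
  have hc : conditionCodes {p | D p.columns} = encode '' {l | D l} := by
    ext x
    exact ⟨fun ⟨p, hp, hx⟩ => ⟨p.columns, hp, hx⟩, fun ⟨l, hl, hx⟩ => ⟨⟨l⟩, hl, hx⟩⟩
  refine hG {p | D p.columns} (fun p => ?_) (hc ▸ DeltaIn.image_encode hD)
  obtain ⟨q, hq, hDq⟩ := hd p.columns
  exact ⟨⟨q⟩, hDq, hq⟩

/-- The set `R ⊕ U` of a filter. -/
def genericOracle (G : Order.PFilter LockCondition) : Set ℕ :=
  join (seqCode (genericSet G)) (unlockedColumns G)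

theorem exists_common_extension {p q : LockCondition} (hp : p ∈ G) (hq : q ∈ G) :
    ∃ r ∈ G, Extends r.columns p.columns ∧ Extends r.columns q.columns := by
  obtain ⟨r, hr, h1, h2⟩ := G.directed p hp q hq
  exact ⟨r, hr, h1, h2⟩

/-- Conditions in a filter are compatible, so none can contradict a decision made by another. -/
theorem mem_genericOracle_iff {p : LockCondition} (hp : p ∈ G) {j : ℕ} {b : Bool}
    (h : Forces p.columns j b) : j ∈ genericOracle G ↔ b = true := by
  rcases h with ⟨m, rfl, ρ, a, h1, h2⟩ | ⟨m, rfl, ρ, a, h1, rfl⟩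
  · refine two_mul_mem_join.trans ⟨fun ⟨q, hq, σ, a', h3, h4⟩ => ?_,
      fun hb => ⟨p, hp, ρ, a, h1, hb ▸ h2⟩⟩
    obtain ⟨r, -, hrp, hrq⟩ := exists_common_extension hp hq
    obtain ⟨_, h5, ⟨t, rfl⟩, -⟩ := hrp.2 _ _ _ h1
    obtain ⟨_, h6, ⟨u, rfl⟩, -⟩ := hrq.2 _ _ _ h3
    simp only [h5, Option.some.injEq, Prod.mk.injEq] at h6
    have h7 := List.getElem?_append_left (l₂ := t) (List.getElem?_eq_some_iff.1 h2).1
    have h8 := List.getElem?_append_left (l₂ := u) (List.getElem?_eq_some_iff.1 h4).1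
    rw [h6.1, h8, h4, h2] at h7
    simpa using h7.symm
  · refine two_mul_add_one_mem_join.trans ⟨fun ⟨q, hq, σ, h3⟩ => ?_,
      fun hb => ⟨p, hp, ρ, by rwa [Option.isNone_iff_eq_none.1 hb] at h1⟩⟩
    obtain ⟨r, -, hrp, hrq⟩ := exists_common_extension hp hq
    obtain ⟨τ, h5, -⟩ := hrp.2 _ _ _ h1
    obtain ⟨τ', h6, -⟩ := hrq.2 _ _ _ h3
    simp only [h5, Option.some.injEq, Prod.mk.injEq] at h6
    simp [h6.2]

theorem initSeg_genericOracle {p : LockCondition} (hp : p ∈ G) {σ : List Bool}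
    (h : ForcesSeg p.columns σ) : initSeg (genericOracle G) σ.length = σ := by
  refine List.ext_getElem? fun i => ?_
  by_cases hi : i < σ.length
  · obtain ⟨b, hb, hf⟩ := h i hi
    rw [hb, initSeg_getElem?_eq_some]
    exact ⟨hi, mem_genericOracle_iff hp hf⟩
  · rw [List.getElem?_eq_none (by simpa using hi), List.getElem?_eq_none (by simpa using hi)]

theorem DeltaIn.iterate_jump {α : Type*} [Primcodable α] {p : α → Prop}
    (hp : DeltaIn (CohLocks.jump X) p) : ∀ n, DeltaIn (CohLocks.jump^[n + 1] X) p
  | 0 => hp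
  | n + 1 => by
    rw [Function.iterate_succ_apply']
    exact (iterate_jump hp n).jump

theorem IsGenericAtLevel.exists_forces (hG : IsGenericAtLevel (n + 1) G) (k : ℕ) :
    ∃ p ∈ G, ∀ j < k, ∃ b, Forces p.columns j b := by
  have h : CEIn ∅ fun p : Columns => ∀ j < k, ∃ b, Forces p j b :=
    .forall_lt (by fun_prop) (.ex (ceIn_forces.comp
      (f := fun x : (Columns × ℕ) × Bool => (x.1.1, x.1.2, x.2)) (by fun_prop)))
  exact hG.exists_mem (h.deltaIn_jump.iterate_jump n) fun p =>
    ⟨grow p k, grow_extends p k, fun j hj => exists_forces_grow p hj⟩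

theorem IsGenericAtLevel.exists_forcesSeg (hG : IsGenericAtLevel (n + 1) G) (k : ℕ) :
    ∃ p ∈ G, ForcesSeg p.columns (initSeg (genericOracle G) k) := by
  obtain ⟨p, hp, h⟩ := hG.exists_forces k
  refine ⟨p, hp, fun j hj => ?_⟩
  simp only [length_initSeg] at hj
  obtain ⟨b, hb⟩ := h j hj
  exact ⟨b, initSeg_getElem?_eq_some _ |>.2 ⟨hj, mem_genericOracle_iff hp hb⟩, hb⟩

/-! ### Forcing `Σ₂` statements -/

/-- Some initial segment of `R ⊕ U` decided by `p` satisfies `r` with parameter `x`. -/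
def ForcesMatrix (r : (ℕ × ℕ) × ℕ × List Bool → Prop) (p : Columns) (x : ℕ × ℕ) : Prop :=
  ∃ σ, ForcesSeg p σ ∧ r (x, σ.length, σ)

/-- `p` forces that no initial segment of `R ⊕ U` satisfies `r` with parameter `x`. -/
def ForcesNot (r : (ℕ × ℕ) × ℕ × List Bool → Prop) (p : Columns) (x : ℕ × ℕ) : Prop :=
  ¬ ∃ q, Extends q p ∧ ForcesMatrix r q x

section

variable {r s : (ℕ × ℕ) × ℕ × List Bool → Prop}

theorem ceIn_forcesMatrix (hr : PrimrecPred r) :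
    CEIn X fun y : Columns × ℕ × ℕ => ForcesMatrix r y.1 y.2 :=
  .ex (.and (ceIn_forcesSeg.comp (f := fun y : (Columns × ℕ × ℕ) × List Bool => (y.1.1, y.2))
    (by fun_prop)) (.of_primrec (hr.comp (by fun_prop))))

/-- Forcing a negation is `Π₁` because extension and `ForcesMatrix` are both enumerable. The
complexity bounds of the main argument rest on this. -/
theorem deltaIn_forcesNot (hr : PrimrecPred r) :
    DeltaIn (jump X) fun y : Columns × ℕ × ℕ => ForcesNot r y.1 y.2 := by
  have h : CEIn X fun y : Columns × ℕ × ℕ => ∃ q, Extends q y.1 ∧ ForcesMatrix r q y.2 :=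
    .ex (.and
      (ceIn_extends.comp (f := fun y : (Columns × ℕ × ℕ) × Columns => (y.2, y.1.1)) (by fun_prop))
      ((ceIn_forcesMatrix hr).comp (f := fun y : (Columns × ℕ × ℕ) × Columns => (y.2, y.1.2))
        (by fun_prop)))
  exact h.deltaIn_jump.not

theorem ForcesNot.mono {p q : Columns} {x : ℕ × ℕ} (h : Extends q p) (hp : ForcesNot r p x) :
    ForcesNot r q x := fun ⟨q', h1, h2⟩ => hp ⟨q', h1.trans h, h2⟩

theorem ForcesNot.not_matrix (hG : IsGenericAtLevel (n + 1) G) {p : LockCondition} (hp : p ∈ G)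
    {x : ℕ × ℕ} (h : ForcesNot r p.columns x) (k : ℕ) : ¬ r (x, k, initSeg (genericOracle G) k) := by
  intro hr
  obtain ⟨q, hq, hσ⟩ := hG.exists_forcesSeg k
  obtain ⟨t, -, h1, h2⟩ := exists_common_extension hp hq
  exact h ⟨t.columns, h1, _, hσ.mono h2, by simpa using hr⟩

/-- It is dense either to force the negation or to verify an instance of `r`; a condition in `G` of
the second kind would make `r` true of the generic oracle. -/
theorem exists_forcesNot (hG : IsGenericAtLevel (n + 1) G) (hr : PrimrecPred r) {x : ℕ × ℕ}
    (h : ∀ k, ¬ r (x, k, initSeg (genericOracle G) k)) : ∃ p ∈ G, ForcesNot r p.columns x := by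
  have hD : DeltaIn (jump ∅) fun p : Columns => ForcesNot r p x ∨ ForcesMatrix r p x :=
    .or ((deltaIn_forcesNot hr).comp (f := fun p : Columns => (p, x)) (by fun_prop))
      ((ceIn_forcesMatrix hr).comp (f := fun p : Columns => (p, x)) (by fun_prop)).deltaIn_jump
  obtain ⟨p, hp, h1 | ⟨σ, hσ, h1⟩⟩ := hG.exists_mem (hD.iterate_jump n) fun p => by
    by_cases hp : ForcesNot r p x
    · exact ⟨p, le_refl (α := LockCondition) _, Or.inl hp⟩
    · obtain ⟨q, hq, h2⟩ := not_not.1 hp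
      exact ⟨q, hq, Or.inr h2⟩
  · exact ⟨p, hp, h1⟩
  · refine absurd ?_ (h σ.length)
    rwa [initSeg_genericOracle hp hσ]

/-- `(R ⊕ U)'` computes no set that separates a pair of sets that is inseparable relative to
`∅'`. -/
theorem IsGenericAtLevel.not_separates (hG : IsGenericAtLevel 3 G) {A B : ℕ → Prop}
    (hA : CEIn (jump ∅) A) (hB : CEIn (jump ∅) B)
    (hAB : ∀ F : ℕ → Prop, DeltaIn (jump ∅) F → ∃ e, (A e ∧ F e) ∨ (B e ∧ ¬ F e))
    {P : ℕ → Prop} (hP : DeltaIn (jump (genericOracle G)) P) :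
    ¬ ∀ e, (A e → ¬ P e) ∧ (B e → P e) := by
  intro hsep
  obtain ⟨q, ⟨r, hr, hq⟩, hPr⟩ := hP.1.exists_not_of_jump
  obtain ⟨q', ⟨s, hs, hq'⟩, hPs⟩ := hP.2.exists_not_of_jump
  simp only [hq, not_exists] at hPr
  simp only [hq', not_exists] at hPs
  have hN : ∀ {r}, PrimrecPred r → CEIn (jump ∅) fun x : Columns × ℕ =>
      ∃ m, ForcesNot r x.1 (x.2, m) := fun hr =>
    .ex ((deltaIn_forcesNot hr).1.comp
      (f := fun x : (Columns × ℕ) × ℕ => (x.1.1, x.1.2, x.2)) (by fun_prop))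
  have hE : ∀ {r}, PrimrecPred r → CEIn (jump ∅) fun x : Columns × ℕ =>
      ∃ t, Extends t x.1 ∧ ∃ m, ForcesNot r t (x.2, m) := fun hr =>
    .ex (.and (ceIn_extends.comp (f := fun x : (Columns × ℕ) × Columns => (x.2, x.1.1))
      (by fun_prop)) ((hN hr).comp (f := fun x : (Columns × ℕ) × Columns => (x.2, x.1.2))
      (by fun_prop)))
  -- Either `p` forces `P` to err at some `e` in `A` or in `B`, or no extension of `p` forces an
  -- answer at some `e`.
  let D : Columns → Prop := fun p => ∃ e, (A e ∧ ∃ m, ForcesNot r p (e, m)) ∨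
    (B e ∧ ∃ m, ForcesNot s p (e, m)) ∨
    ¬ ((∃ t, Extends t p ∧ ∃ m, ForcesNot r t (e, m)) ∨
      ∃ t, Extends t p ∧ ∃ m, ForcesNot s t (e, m))
  have hD : DeltaIn (jump^[3] ∅) D := by
    -- The clauses are decidable in `∅''`, so `D` is enumerable in it and decidable in `∅'''`: this
    -- is why level 3 suffices.
    refine CEIn.deltaIn_jump (X := jump (jump ∅)) (.ex ?_)
    exact .or (.and (hA.deltaIn_jump.1.comp (by fun_prop)) (hN hr).deltaIn_jump.1)
      (.or (.and (hB.deltaIn_jump.1.comp (by fun_prop)) (hN hs).deltaIn_jump.1)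
      ((hE hr).or (hE hs)).deltaIn_jump.2)
  obtain ⟨p, hp, e, h | h | h⟩ := hG.exists_mem hD fun p => by
    by_contra hcon
    push Not at hcon
    -- With no extension in `D`, every `e` has a forceable answer, so the reduced sets `F` and `F'`
    -- are complementary and `F` is decidable in `∅'`.
    obtain ⟨F, F', hF, hF', h1, h2, h3, h4⟩ := CEIn.reduction
      ((hE hr).comp (f := fun e : ℕ => (p, e)) (by fun_prop))
      ((hE hs).comp (f := fun e : ℕ => (p, e)) (by fun_prop))
    have h5 : ∀ e, F e ∨ F' e := fun e => h4 e (by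
      by_contra h
      exact hcon p (le_refl (α := LockCondition) _) ⟨e, Or.inr (Or.inr h)⟩)
    have hFF : ∀ e, ¬ F e ↔ F' e := fun e => by
      have := h3 e
      have := h5 e
      tauto
    obtain ⟨e, ⟨hAe, hFe⟩ | ⟨hBe, hFe⟩⟩ := hAB F ⟨hF, hF'.of_iff hFF⟩
    · obtain ⟨t, ht, hm⟩ := h1 e hFe
      exact hcon t ht ⟨e, Or.inl ⟨hAe, hm⟩⟩
    · obtain ⟨t, ht, hm⟩ := h2 e ((hFF e).1 hFe)
      exact hcon t ht ⟨e, Or.inr (Or.inl ⟨hBe, hm⟩)⟩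
  · obtain ⟨hAe, m, hm⟩ := h
    exact (hsep e).1 hAe ((hPr e).2 ⟨m, hm.not_matrix hG hp⟩)
  · obtain ⟨hBe, m, hm⟩ := h
    exact (hPs e).2 ⟨m, hm.not_matrix hG hp⟩ ((hsep e).2 hBe)
  -- The true answer at `e` is forced by some condition in `G`, and a common extension with `p`
  -- contradicts the third clause.
  · by_cases hPe : P e
    · obtain ⟨m, hm⟩ := (hPr e).1 hPe
      obtain ⟨t, ht, hN⟩ := exists_forcesNot hG hr hm
      obtain ⟨u, -, hup, hut⟩ := exists_common_extension hp ht
      exact h (Or.inl ⟨u.columns, hup, m, hN.mono hut⟩)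
    · obtain ⟨m, hm⟩ := (hPs e).1 hPe
      obtain ⟨t, ht, hN⟩ := exists_forcesNot hG hs hm
      obtain ⟨u, -, hup, hut⟩ := exists_common_extension hp ht
      exact h (Or.inr ⟨u.columns, hup, m, hN.mono hut⟩)

end

end CohLocks

namespace CohLocks

open Encodable Filter

variable {G : Order.PFilter LockCondition} {n : ℕ}

/-! ### A cohesive set computable from `R ⊕ U` -/

/-- The numbers `⟨s, y⟩`, where `y` is least such that `⟨s, y⟩` belongs to all the unlocked columns
below `s`. -/
def cohesiveSet (G : Order.PFilter LockCondition) : Set ℕ :=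
  {x | (∀ i < x.unpair.1, i ∈ unlockedColumns G → x ∈ genericSet G i) ∧
    ∀ y < x.unpair.2, ¬ ∀ i < x.unpair.1, i ∈ unlockedColumns G →
      Nat.pair x.unpair.1 y ∈ genericSet G i}

theorem deltaIn_cohesiveSet (G : Order.PFilter LockCondition) :
    DeltaIn (genericOracle G) (· ∈ cohesiveSet G) := by
  have hR : DeltaIn (genericOracle G) fun x : ℕ × ℕ => x.2 ∈ genericSet G x.1 :=
    ((deltaIn_join_left _ _).comp (f := fun x : ℕ × ℕ => Nat.pair x.1 x.2)
      (by fun_prop)).of_iff fun x => by simp [seqCode]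
  have hU : DeltaIn (genericOracle G) (· ∈ unlockedColumns G) := deltaIn_join_right _ _
  exact .and
    (.forall_lt (by fun_prop) (.imp (hU.comp (by fun_prop))
      (hR.comp (f := fun x : ℕ × ℕ => (x.2, x.1)) (by fun_prop))))
    (.forall_lt (by fun_prop) (DeltaIn.not (.forall_lt (by fun_prop)
      (.imp (hU.comp (by fun_prop))
        (hR.comp (f := fun x : (ℕ × ℕ) × ℕ => (x.2, Nat.pair x.1.1.unpair.1 x.1.2))
          (by fun_prop))))))

theorem IsGenericAtLevel.exists_getElem? (hG : IsGenericAtLevel (n + 1) G) (i x : ℕ) :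
    ∃ p ∈ G, ∃ σ a, p.columns[i]? = some (σ, a) ∧ x < σ.length := by
  obtain ⟨p, hp, h⟩ := hG.exists_forces (2 * Nat.pair i x + 1)
  obtain ⟨b, ⟨m, hm, ρ, a, h1, h2⟩ | ⟨m, hm, -⟩⟩ := h (2 * Nat.pair i x) (by omega)
  · obtain rfl : Nat.pair i x = m := by omega
    rw [Nat.unpair_pair] at h1 h2
    exact ⟨p, hp, ρ, a, h1, (List.getElem?_eq_some_iff.1 h2).1⟩
  · omega

/-- A column that is locked to `b` is almost constant, with value `b`. -/
theorem mem_genericSet_iff_of_locked (hG : IsGenericAtLevel (n + 1) G) {p : LockCondition}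
    (hp : p ∈ G) {i : ℕ} {σ : List Bool} {b : Bool} (h : p.columns[i]? = some (σ, some b)) {x : ℕ}
    (hx : σ.length ≤ x) : x ∈ genericSet G i ↔ b = true := by
  obtain ⟨q, hq, ρ, a, h1, h2⟩ := hG.exists_getElem? i x
  obtain ⟨r, hr, hrp, hrq⟩ := exists_common_extension hp hq
  obtain ⟨τ, h3, -, h4⟩ := hrp.2 _ _ _ h
  obtain ⟨τ', h5, h6, -⟩ := hrq.2 _ _ _ h1
  simp only [h3, Option.some.injEq, Prod.mk.injEq] at h5
  obtain ⟨rfl, rfl⟩ := h5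
  have h7 := h4 b rfl x hx (h2.trans_le h6.length_le)
  have h8 : Forces r.columns (2 * Nat.pair i x) b :=
    Or.inl ⟨Nat.pair i x, rfl, τ, some b, by simpa using h3, by simpa using h7⟩
  have h9 := mem_genericOracle_iff hr h8
  rw [genericOracle, two_mul_mem_join] at h9
  simpa [seqCode] using h9

/-- Beyond the strings of a condition the unlocked columns are free, so they can all be given a one
at the same place `⟨s, y⟩`. -/
theorem IsGenericAtLevel.exists_mem_inter (hG : IsGenericAtLevel (n + 1) G) (s : ℕ) :
    ∃ y, ∀ i < s, i ∈ unlockedColumns G → Nat.pair s y ∈ genericSet G i := by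
  have hD : CEIn ∅ fun p : Columns => ∃ y, ∀ i < s, ∃ σ a, p[i]? = some (σ, a) ∧
      (a.isNone = false ∨ σ[Nat.pair s y]? = some true) :=
    .ex (.forall_lt (by fun_prop) (.ex (.ex (.and
      (.of_primrec (.eq_of (by fun_prop) (by fun_prop)))
      (.or (.of_primrec (.eq_of (by fun_prop) (by fun_prop)))
        (.of_primrec (.eq_of (by fun_prop) (by fun_prop))))))))
  obtain ⟨p, hp, y, hy⟩ := hG.exists_mem (hD.deltaIn_jump.iterate_jump n) fun p => by
    -- The sum bounds every string length, hence so does `⟨s, y⟩`; growing to `⟨s, y⟩ + 1` covers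
    -- that position and all columns below `s`.
    let y := (p.map fun c => c.1.length).sum
    refine ⟨_, grow_extends p (Nat.pair s y + 1), y, fun i hi => ?_⟩
    obtain ⟨σ, a, h1, -, h2⟩ := grow_getElem? p
      (show i < Nat.pair s y + 1 by have := Nat.left_le_pair s y; omega)
    refine ⟨σ, a, h1, ?_⟩
    cases a with
    | some b => exact Or.inl rfl
    | none =>
      refine Or.inr (h2 _ (Nat.lt_succ_self _) (fun c hc => ?_) rfl)
      exact (List.single_le_sum (by simp) _ (List.mem_map_of_mem hc)).trans (Nat.right_le_pair s y)
  refine ⟨y, fun i hi ⟨q, hq, σ', h3⟩ => ?_⟩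
  obtain ⟨σ, a, h1, h2⟩ := hy i hi
  obtain ⟨r, -, hrp, hrq⟩ := exists_common_extension hp hq
  obtain ⟨τ, h4, -⟩ := hrp.2 _ _ _ h1
  obtain ⟨τ', h5, -⟩ := hrq.2 _ _ _ h3
  simp only [h4, Option.some.injEq, Prod.mk.injEq] at h5
  obtain ⟨rfl, rfl⟩ := h5
  exact ⟨p, hp, σ, none, h1, by simpa using h2⟩

theorem IsGenericAtLevel.isCohSolution (hG : IsGenericAtLevel (n + 1) G) :
    IsCohSolution (genericSet G) (cohesiveSet G) := by
  classical
  constructor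
  · refine Set.infinite_of_injective_forall_mem
      (f := fun s => Nat.pair s (Nat.find (hG.exists_mem_inter s))) (fun s t h => ?_) fun s => ?_
    · simpa using congrArg (fun x => x.unpair.1) h
    · simp only [cohesiveSet, Set.mem_ofPred_eq, Nat.unpair_pair]
      exact ⟨Nat.find_spec (hG.exists_mem_inter s), fun y => Nat.find_min (hG.exists_mem_inter s)⟩
  · intro i
    by_cases hi : i ∈ unlockedColumns G
    · refine Or.inl ?_
      -- Leastness of `y` leaves one element per `s`, so only finitely many elements have `s ≤ i`
      -- and may miss column `i`.
      have hinj : Set.InjOn (fun x : ℕ => x.unpair.1) (cohesiveSet G) := by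
        intro x hx y hy hxy
        simp only at hxy
        have h2 : x.unpair.2 = y.unpair.2 := by
          refine le_antisymm (not_lt.1 fun h => hx.2 _ h ?_) (not_lt.1 fun h => hy.2 _ h ?_)
          · rw [hxy, Nat.pair_unpair]
            exact hy.1
          · rw [← hxy, Nat.pair_unpair]
            exact hx.1
        rw [← Nat.pair_unpair x, ← Nat.pair_unpair y, hxy, h2]
      refine Set.Finite.of_finite_image ((Set.finite_Iic i).subset ?_)
        (hinj.mono Set.sdiff_subset)
      rintro _ ⟨x, ⟨hx, hxi⟩, rfl⟩
      exact not_lt.1 fun h => hxi (hx.1 i h hi)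
    · obtain ⟨p, hp, σ, a, h, -⟩ := hG.exists_getElem? i 0
      cases a with
      | none => exact absurd ⟨p, hp, σ, h⟩ hi
      | some b =>
        have hfin := fun x => mem_genericSet_iff_of_locked hG hp h (x := x)
        cases b with
        | true =>
          refine Or.inl ((Set.finite_Iio σ.length).subset fun x hx => Set.mem_Iio.2 (not_le.1 fun hle => ?_))
          exact hx.2 ((hfin x hle).2 rfl)
        | false =>
          refine Or.inr ((Set.finite_Iio σ.length).subset fun x hx => Set.mem_Iio.2 (not_le.1 fun hle => ?_))
          simpa using (hfin x hle).1 (not_not.1 hx.2)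

/-! ### Cohesiveness and separating sets -/

/-- A pair of disjoint sets that are computably enumerable in `∅'` yields a computable instance of
`COH` such that the jump of each solution computes a separating set. -/
theorem exists_cohInstance_separating {A B : ℕ → Prop} (hA : CEIn (jump ∅) A)
    (hB : CEIn (jump ∅) B) (hd : ∀ e, ¬ (A e ∧ B e)) :
    ∃ S : ℕ → Set ℕ, DeltaIn ∅ (· ∈ seqCode S) ∧ ∀ D, IsCohSolution S D →
      ∃ P : ℕ → Prop, DeltaIn (jump D) P ∧ ∀ e, (A e → ¬ P e) ∧ (B e → P e) := by
  obtain ⟨q, ⟨r, hr, hq⟩, hAq⟩ := hA.exists_not_of_jump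
  obtain ⟨q', ⟨s, hs, hq'⟩, hBq⟩ := hB.exists_not_of_jump
  simp only [hq, not_exists] at hAq
  simp only [hq', not_exists] at hBq
  -- Witnesses for `A e` race against witnesses for `B e`: `t ∈ S e` if some `m < t` is unrefuted
  -- for `A` at stage `t` while all `m' < m` are refuted for `B`. A true witness on one side
  -- survives and those on the other side are all refuted, so `S e` is eventually everything on `A`
  -- and eventually empty on `B`.
  let S : ℕ → Set ℕ := fun e => {t | ∃ m < t, (∀ k < t, ¬ r ((e, m), k, initSeg ∅ k)) ∧
    ∀ m' < m, ∃ k < t, s ((e, m'), k, initSeg ∅ k)}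
  have hS : DeltaIn ∅ (· ∈ seqCode S) := by
    have h : DeltaIn ∅ fun x : ℕ => ∃ m < x.unpair.2,
        (∀ k < x.unpair.2, ¬ r ((x.unpair.1, m), k, initSeg ∅ k)) ∧
        ∀ m' < m, ∃ k < x.unpair.2, s ((x.unpair.1, m'), k, initSeg ∅ k) :=
      .exists_lt (by fun_prop) (.and
        (.forall_lt (by fun_prop) (DeltaIn.matrix hr (by fun_prop) (by fun_prop)).not)
        (.forall_lt (by fun_prop) (.exists_lt (by fun_prop)
          (.matrix hs (by fun_prop) (by fun_prop)))))
    exact h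
  have hev : ∀ {r : (ℕ × ℕ) × ℕ × List Bool → Prop} {e M},
      (∀ m < M, ∃ k, r ((e, m), k, initSeg ∅ k)) →
      ∀ᶠ t in atTop, ∀ m < M, ∃ k < t, r ((e, m), k, initSeg ∅ k) := by
    intro r e M h
    refine (eventually_all_finite (Set.finite_Iio M)).2 fun m hm => ?_
    obtain ⟨k, hk⟩ := h m hm
    filter_upwards [eventually_gt_atTop k] with t ht using ⟨k, ht, hk⟩
  have hSA : ∀ e, A e → ∀ᶠ t in atTop, t ∈ S e := by
    intro e he
    obtain ⟨m, hm⟩ := (hAq e).1 he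
    have hne := not_exists.1 fun h => hd e ⟨he, (hBq e).2 h⟩
    filter_upwards [eventually_gt_atTop m, hev (r := s) (e := e) (M := m)
      fun m' _ => by simpa using hne m'] with t ht h
    exact ⟨m, ht, fun k _ => hm k, h⟩
  have hSB : ∀ e, B e → ∀ᶠ t in atTop, t ∉ S e := by
    intro e he
    obtain ⟨m', hm'⟩ := (hBq e).1 he
    have hne := not_exists.1 fun h => hd e ⟨(hAq e).2 h, he⟩
    filter_upwards [hev (r := r) (e := e) (M := m' + 1) fun m _ => by simpa using hne m] with t h
    rintro ⟨m, -, h1, h2⟩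
    have hlt : m' < m := by
      by_contra hle
      obtain ⟨k, hk, hrk⟩ := h m (by omega)
      exact h1 k hk hrk
    obtain ⟨k, -, hk⟩ := h2 m' hlt
    exact hm' k hk
  refine ⟨S, hS, fun D ⟨hinf, hcoh⟩ => ?_⟩
  have hfreq : ∃ᶠ t in atTop, t ∈ D := Nat.frequently_atTop_iff_infinite.2 hinf
  have hlim : ∀ p : ℕ → Prop, (∃ m, ∀ t, m ≤ t → t ∈ D → p t) ↔
      ∀ᶠ t in atTop, t ∈ D → p t := fun p => eventually_atTop.symm
  let P : ℕ → Prop := fun e => ∃ m, ∀ t, m ≤ t → t ∈ D → t ∉ S e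
  -- Cohesiveness and infinitude of `D` give the complement of `P` the same `Σ₂` form, so `P` is
  -- decidable in the jump of `D`.
  have hnot : ∀ e, ¬ P e ↔ ∃ m, ∀ t, m ≤ t → t ∈ D → t ∈ S e := by
    refine fun e => ⟨fun h => ?_, fun h1 h2 => ?_⟩
    · have hfin : (D \ S e).Finite := (hcoh e).resolve_right fun hfin => h ?_
      · obtain ⟨m, hm⟩ := hfin.bddAbove
        exact ⟨m + 1, fun t ht htD => not_not.1 fun h =>
          absurd (hm ⟨htD, fun hS => h hS⟩) (by omega)⟩
      · obtain ⟨m, hm⟩ := hfin.bddAbove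
        exact ⟨m + 1, fun t ht htD => not_not.1 fun h => absurd (hm ⟨htD, h⟩) (by omega)⟩
    · rw [hlim] at h1
      obtain ⟨t, h3, h4, h5⟩ := (hfreq.and_eventually (h1.and ((hlim _).1 h2))).exists
      exact h5 h3 (h4 h3)
  have hSD : DeltaIn D fun x : ℕ × ℕ => x.2 ∈ S x.1 :=
    (hS.of_empty.comp (f := fun x : ℕ × ℕ => Nat.pair x.1 x.2) (by fun_prop)).of_iff
      fun x => by simp [seqCode]
  have hce : ∀ {W : ℕ × ℕ → Prop}, DeltaIn D W →
      CEIn (jump D) fun e => ∃ m, ∀ t, m ≤ t → t ∈ D → W (e, t) := by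
    intro W hW
    have h : CEIn D fun x : ℕ × ℕ => ∃ t, x.2 ≤ t ∧ t ∈ D ∧ ¬ W (x.1, t) :=
      .ex (.and (.of_primrec (.le_of (by fun_prop) (by fun_prop))) (.and (.mem (by fun_prop))
        (hW.2.comp (f := fun x : (ℕ × ℕ) × ℕ => (x.1.1, x.2)) (by fun_prop))))
    refine .ex (h.deltaIn_jump.2.of_iff fun x => ?_)
    push Not
    rfl
  have hP : DeltaIn (jump D) P := ⟨hce hSD.not, (hce hSD).of_iff hnot⟩
  refine ⟨P, hP, fun e => ⟨fun he hPe => ?_, fun he => ?_⟩⟩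
  · obtain ⟨t, h3, h4, h5⟩ := (hfreq.and_eventually ((hSA e he).and ((hlim _).1 hPe))).exists
    exact h5 h3 h4
  · exact (hlim _).2 ((hSB e he).mono fun t h _ => h)

end CohLocks

/-! ### The corollary -/

open CohLocks
/-- For all sufficiently generic filters `G` (those that meet every dense set of conditions
computable from a fixed finite jump of the empty set), there is an infinite cohesive set `C` for
the generic sequence, computable from the sequence and the set of unlocked columns, such that
`(R^G ⊕ C)'` is not of PA degree relative to `0'`, nor relative to `(R^G)'`; and `R^G` is not
a universal instance of `COH`. -/
theorem mainTheorem6 :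
    ∃ n : ℕ, ∀ G : Order.PFilter LockCondition, IsGenericAtLevel n G →
      (∃ C : Set ℕ, IsCohSolution (genericSet G) C ∧
        SetReducible C (join (seqCode (genericSet G)) (unlockedColumns G)) ∧
        ¬ IsPARelativeTo (jump (join (seqCode (genericSet G)) C)) (jump ∅) ∧
        ¬ IsPARelativeTo (jump (join (seqCode (genericSet G)) C))
          (jump (seqCode (genericSet G)))) ∧
      ¬ IsUniversalCohInstance (seqCode (genericSet G)) (genericSet G) := by
  refine ⟨3, fun G hG => ?_⟩
  obtain ⟨A, B, hA, hB, hd, hAB⟩ := exists_inseparable (jump ∅)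
  have hC := deltaIn_cohesiveSet G
  have hJ : DeltaIn (jump (genericOracle G))
      (· ∈ jump (join (seqCode (genericSet G)) (cohesiveSet G))) :=
    ((deltaIn_join_left _ _).join hC).jump_mono
  have hsep : ∀ P : ℕ → Prop, DeltaIn (jump (join (seqCode (genericSet G)) (cohesiveSet G))) P →
      ¬ ∀ e, (A e → ¬ P e) ∧ (B e → P e) :=
    fun P hP => hG.not_separates hA hB hAB (hP.trans hJ)
  obtain ⟨T, hT, hTinf, hTd, hTP⟩ := exists_tree_of_disjoint hA hB hd
  -- Any `Z` computing `∅'` computes the tree, which treats `∅'` and the jump of `R` at once.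
  have hPA : ∀ Z, DeltaIn Z (· ∈ jump ∅) →
      ¬ IsPARelativeTo (jump (join (seqCode (genericSet G)) (cohesiveSet G))) Z := by
    intro Z hZ h
    obtain ⟨P, hP, hpath⟩ := h T hT hTinf (hTd.trans hZ).image_encode
    exact hsep (· ∈ P) (setReducible_iff.1 hP) (hTP P hpath)
  refine ⟨⟨cohesiveSet G, hG.isCohSolution, setReducible_iff.2 hC, hPA _ (.mem .id),
    hPA _ (DeltaIn.mem .id).of_empty.jump_mono⟩, fun ⟨_, h⟩ => ?_⟩
  obtain ⟨S, hS, hSP⟩ := exists_cohInstance_separating hA hB hd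
  obtain ⟨D, hD, hDS⟩ := h S (setReducible_iff.2 hS.of_empty) _ hG.isCohSolution
  obtain ⟨P, hP, hPsep⟩ := hSP D hDS
  exact hsep P (hP.trans (setReducible_iff.1 hD).jump_mono) hPsep
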